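/- Let $d\ge 1$, let $u\in\mathbb C$ with $u\neq 0$, and let $n\ge 3$. Let $\mathrm Y_{d,n}(u)$ be the Yokonuma--Hecke algebra of type $A$ over $\mathbb C$, with generators $g_1,\dots,g_{n-1},t_1,\dots,t_n$, the braid relations for the $g_i$, and the relations $t_it_j=t_jt_i$, $t_jg_i=g_it_{s_i(j)}$, $t_i^d=1$ and $g_i^2=1+(u-1)e_i+(u-1)e_ig_i$, where $e_i=\frac1d\sum_{s=0}^{d-1}t_i^st_{i+1}^{d-s}$. For $z\in\mathbb C$ and $x:\mathbb Z/d\mathbb Z\to\mathbb C$ with $x_0=1$, let $\mathrm{tr}$ be the Juyumaya trace with parameters $z,x_1,\dots,x_{d-1}$, that is, the linear functional on the inductive limit $\bigcup_n\mathrm Y_{d,n}(u)$ with $\mathrm{tr}(1)=1$, $\mathrm{tr}(ab)=\mathrm{tr}(ba)$, $\mathrm{tr}(ag_n)=z\,\mathrm{tr}(a)$ and $\mathrm{tr}(at_{n+1}^m)=x_m\mathrm{tr}(a)$ for $a,b\in\mathrm Y_{d,n}(u)$ and $1\le m\le d-1$; there is at most one such functional for given parameters. Let $\mathrm{FTL}_{d,n}(u)$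 be the quotient of $\mathrm Y_{d,n}(u)$ by the two-sided ideal generated by all $$r_{i,i+1}=\sum_{\alpha+\beta+\gamma=0}t_i^\alpha t_{i+1}^\beta t_{i+2}^\gamma\,(g_ig_{i+1}g_i+g_{i+1}g_i+g_ig_{i+1}+g_i+g_{i+1}+1),$$ the sum being over $\alpha,\beta,\gamma\in\mathbb Z/d\mathbb Z$. The trace with parameters $(z,x)$ \emph{passes} to $\mathrm{FTL}_{d,n}(u)$ if $\mathrm{tr}$ (exists and) factors through $\mathrm{FTL}_{d,n}(u)$ on $\mathrm Y_{d,n}(u)$. The E-system is $\sum_s x_{m+s}x_{-s}=x_m\sum_s x_sx_{-s}$ for all $m\ne0$ in $\mathbb Z/d\mathbb Z$, with $x_0=1$. Its solutions are exactly the functions $x^D_m=\frac1{|D|}\sum_{k\in D}e^{2\pi ikm/d}$ for $D\subseteq\mathbb Z/d\mathbb Z$ non-empty, and $D$ is determined by $x^D$. Let $y_k=\sum_m x_me^{-2\pi ikm/d}$ be the Fourier transform of $x$ and put $$D_1=\{k: y_k\ne0,\ y_k=-dz\},\qquad D_2=\{k: y_k\neq0,\ y_k=-dz(u+1)\}.$$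 (1) Suppose that the trace with parameters $(z,x)$ passes to $\mathrm{FTL}_{d,n}(u)$. Then $D_1=\emptyset$ or $D_2=\emptyset$ if and only if $x$ solves the E-system. If $D_1=\emptyset$, then $D_2\neq\emptyset$, $x=x^{D_2}$, $u\ne-1$ and $z=-\frac1{(u+1)|D_2|}$. If $D_2=\emptyset$, then $D_1\ne\emptyset$, $x=x^{D_1}$ and $z=-\frac1{|D_1|}$. (2) Conversely, let $D$ be a non-empty subset of $\mathbb Z/d\mathbb Z$. If $u\ne-1$ and $z=-\frac1{(u+1)|D|}$, then the trace with parameters $(z,x^D)$ passes to $\mathrm{FTL}_{d,n}(u)$, with $D_1=\emptyset$ and $D_2=D$. If $z=-\frac1{|D|}$, then the trace with parameters $(z,x^D)$ passes to $\mathrm{FTL}_{d,n}(u)$, with $D_2=\emptyset$ and $D_1=D$. (3) Consequently the framed Jones polynomial can be defined: let $u\ne-1$, let $D$ be non-empty, $z=-\frac1{(u+1)|D|}$, and let $\mathrm{tr}_D$ be the trace with parameters $(z,x^D)$. Then $\lambda_D:=\frac{|D|z+1-u}{|D|uz}$ equals $u$, and for each choice of $\sqrt u$ the number $$\Big(\frac1{z\sqrt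 u}\Big)^{N-1}(\sqrt u)^{\epsilon(\alpha)}\,\mathrm{tr}_D(\gamma(\alpha)),$$ for $\alpha$ in the framed braid group $\mathcal F_N$, $N\ge1$, depends only on the class of $\alpha$ under framed braid equivalence (generated by conjugation in the groups $\mathcal F_N$ and $\alpha\sim\alpha\sigma_N^{\pm1}$, $\alpha\in\mathcal F_N$), that is, on the oriented framed link that is the closure of $\alpha$. Here $\epsilon(\alpha)$ is the exponent sum of the $\sigma_i$ in $\alpha$ and $\gamma$ is the representation $\sigma_i\mapsto g_i$, $t_j\mapsto t_j$. -/

import Mathlib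

open scoped BigOperators

namespace FramizationTL

noncomputable section

/-! Strands and residues are numbered from `0`: the braiding generator `g i` crosses the strands
`i` and `i + 1`, and `t j` is the framing generator on the strand `j`. -/

/-- The generators on `n` strands: `n - 1` braiding ones and `n` framing ones. -/
inductive Gen (n : ℕ) : Type
  | g (i : ℕ) (hi : i + 1 < n) : Gen n
  | t (j : Fin n) : Gen n

/-- The transposition `s_i` of the strands `i` and `i + 1`. -/
def strandSwap {n : ℕ} (i : ℕ) (hi : i + 1 < n) : Equiv.Perm (Fin n) :=
  Equiv.swap ⟨i, Nat.lt_of_succ_lt hi⟩ ⟨i + 1, hi⟩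

/-! ### The Yokonuma--Hecke algebra -/

/-- The element `(1/d) ∑_{s=0}^{d-1} a^s b^(d-s)` of a complex algebra. -/
def framingAverage {A : Type*} [Ring A] [Algebra ℂ A] (d : ℕ) (a b : A) : A :=
  (d : ℂ)⁻¹ • ∑ s ∈ Finset.range d, a ^ s * b ^ (d - s)

/-- A generator as an element of the free algebra. -/
abbrev fg {n : ℕ} (i : ℕ) (hi : i + 1 < n) : FreeAlgebra ℂ (Gen n) :=
  FreeAlgebra.ι ℂ (Gen.g i hi)

/-- A generator as an element of the free algebra. -/
abbrev ft {n : ℕ} (j : Fin n) : FreeAlgebra ℂ (Gen n) :=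
  FreeAlgebra.ι ℂ (Gen.t j)

/-- The free-algebra word for `e_i`. -/
def fe (d : ℕ) {n : ℕ} (i : ℕ) (hi : i + 1 < n) : FreeAlgebra ℂ (Gen n) :=
  framingAverage d (ft ⟨i, Nat.lt_of_succ_lt hi⟩) (ft ⟨i + 1, hi⟩)

/-- The defining relations of the Yokonuma--Hecke algebra `Y_{d,n}(u)`. -/
inductive YHRel (d : ℕ) (u : ℂ) (n : ℕ) :
    FreeAlgebra ℂ (Gen n) → FreeAlgebra ℂ (Gen n) → Prop
  | far (i j : ℕ) (hi : i + 1 < n) (hj : j + 1 < n) (hij : i + 1 < j) :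
      YHRel d u n (fg i hi * fg j hj) (fg j hj * fg i hi)
  | braid (i : ℕ) (hi : i + 1 < n) (hj : i + 1 + 1 < n) :
      YHRel d u n (fg i hi * fg (i + 1) hj * fg i hi) (fg (i + 1) hj * fg i hi * fg (i + 1) hj)
  | framing_comm (i j : Fin n) : YHRel d u n (ft i * ft j) (ft j * ft i)
  | framing_braid (i : ℕ) (hi : i + 1 < n) (j : Fin n) :
      YHRel d u n (ft j * fg i hi) (fg i hi * ft (strandSwap i hi j))
  | framing_pow (j : Fin n) : YHRel d u n (ft j ^ d) 1
  | quadratic (i : ℕ) (hi : i + 1 < n) :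
      YHRel d u n (fg i hi ^ 2) (1 + (u - 1) • fe d i hi + (u - 1) • (fe d i hi * fg i hi))

/-- The Yokonuma--Hecke algebra `Y_{d,n}(u)` of type `A`. -/
abbrev YH (d : ℕ) (u : ℂ) (n : ℕ) : Type := RingQuot (YHRel d u n)

/-- The quotient map from the free algebra. -/
def YH.mk (d : ℕ) (u : ℂ) (n : ℕ) : FreeAlgebra ℂ (Gen n) →ₐ[ℂ] YH d u n :=
  RingQuot.mkAlgHom ℂ (YHRel d u n)

/-- The braiding generator `g_i` of `Y_{d,n}(u)`. -/
def YH.g {d : ℕ} {u : ℂ} {n : ℕ} (i : ℕ) (hi : i + 1 < n) : YH d u n := YH.mk d u n (fg i hi)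

/-- The framing generator `t_j` of `Y_{d,n}(u)`. -/
def YH.t {d : ℕ} {u : ℂ} {n : ℕ} (j : Fin n) : YH d u n := YH.mk d u n (ft j)

/-- The element `e_i` of `Y_{d,n}(u)`. -/
def YH.e {d : ℕ} {u : ℂ} {n : ℕ} (i : ℕ) (hi : i + 1 < n) : YH d u n :=
  framingAverage d (YH.t ⟨i, Nat.lt_of_succ_lt hi⟩) (YH.t ⟨i + 1, hi⟩)

lemma map_framingAverage {A B : Type*} [Ring A] [Algebra ℂ A] [Ring B] [Algebra ℂ B]
    (f : A →ₐ[ℂ] B) (d : ℕ) (a b : A) :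
    f (framingAverage d a b) = framingAverage d (f a) (f b) := by
  simp [framingAverage, map_sum]

lemma YH.mk_fe {d : ℕ} {u : ℂ} {n : ℕ} (i : ℕ) (hi : i + 1 < n) :
    YH.mk d u n (fe d i hi) = YH.e i hi := map_framingAverage _ _ _ _

section relations

variable {d : ℕ} {u : ℂ} {n : ℕ}

lemma YH.far (i j : ℕ) (hi : i + 1 < n) (hj : j + 1 < n) (hij : i + 1 < j) :
    (YH.g i hi * YH.g j hj : YH d u n) = YH.g j hj * YH.g i hi := by
  have h : YH.mk d u n _ = YH.mk d u n _ :=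
    RingQuot.mkAlgHom_rel ℂ (YHRel.far (d := d) (u := u) i j hi hj hij)
  simp only [map_mul] at h
  exact h

lemma YH.braid (i : ℕ) (hi : i + 1 < n) (hj : i + 1 + 1 < n) :
    (YH.g i hi * YH.g (i + 1) hj * YH.g i hi : YH d u n)
      = YH.g (i + 1) hj * YH.g i hi * YH.g (i + 1) hj := by
  have h : YH.mk d u n _ = YH.mk d u n _ :=
    RingQuot.mkAlgHom_rel ℂ (YHRel.braid (d := d) (u := u) i hi hj)
  simp only [map_mul] at h
  exact h

lemma YH.framing_comm (i j : Fin n) : (YH.t i * YH.t j : YH d u n) = YH.t j * YH.t i := by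
  have h : YH.mk d u n _ = YH.mk d u n _ :=
    RingQuot.mkAlgHom_rel ℂ (YHRel.framing_comm (d := d) (u := u) i j)
  simp only [map_mul] at h
  exact h

lemma YH.framing_braid (i : ℕ) (hi : i + 1 < n) (j : Fin n) :
    (YH.t j * YH.g i hi : YH d u n) = YH.g i hi * YH.t (strandSwap i hi j) := by
  have h : YH.mk d u n _ = YH.mk d u n _ :=
    RingQuot.mkAlgHom_rel ℂ (YHRel.framing_braid (d := d) (u := u) i hi j)
  simp only [map_mul] at h
  exact h

lemma YH.framing_pow (j : Fin n) : (YH.t j ^ d : YH d u n) = 1 := by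
  have h : YH.mk d u n _ = YH.mk d u n _ :=
    RingQuot.mkAlgHom_rel ℂ (YHRel.framing_pow (d := d) (u := u) j)
  simp only [map_pow, map_one] at h
  exact h

lemma YH.quadratic (i : ℕ) (hi : i + 1 < n) :
    (YH.g i hi ^ 2 : YH d u n)
      = 1 + (u - 1) • YH.e i hi + (u - 1) • (YH.e i hi * YH.g i hi) := by
  have h := RingQuot.mkAlgHom_rel ℂ (YHRel.quadratic (d := d) (u := u) i hi)
  change YH.mk d u n _ = YH.mk d u n _ at h
  simp only [map_add, map_mul, map_pow, map_smul, map_one, YH.mk_fe] at h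
  exact h

end relations

lemma strandSwap_castSucc {n : ℕ} (i : ℕ) (hi : i + 1 < n) (j : Fin n) :
    (strandSwap i hi j).castSucc = strandSwap i (Nat.lt_succ_of_lt hi) j.castSucc := by
  unfold strandSwap
  rw [(Fin.castSucc_injective n).map_swap]
  rfl

/-- The images of the generators under the embedding `Y_{d,n}(u) → Y_{d,n+1}(u)`. -/
def YH.inclGen (d : ℕ) (u : ℂ) (n : ℕ) : Gen n → YH d u (n + 1)
  | Gen.g i hi => YH.g i (Nat.lt_succ_of_lt hi)
  | Gen.t j => YH.t j.castSucc

lemma YH.inclGen_rel (d : ℕ) (u : ℂ) (n : ℕ) ⦃a b : FreeAlgebra ℂ (Gen n)⦄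
    (h : YHRel d u n a b) :
    FreeAlgebra.lift ℂ (YH.inclGen d u n) a = FreeAlgebra.lift ℂ (YH.inclGen d u n) b := by
  have he (i : ℕ) (hi : i + 1 < n) :
      FreeAlgebra.lift ℂ (YH.inclGen d u n) (fe d i hi) = YH.e i (Nat.lt_succ_of_lt hi) := by
    rw [fe, map_framingAverage, FreeAlgebra.lift_ι_apply, FreeAlgebra.lift_ι_apply]
    rfl
  cases h with
  | far i j hi hj hij => simpa [YH.inclGen] using YH.far i j _ _ hij
  | braid i hi hj => simpa [YH.inclGen] using YH.braid i _ _
  | framing_comm i j => simpa [YH.inclGen] using YH.framing_comm _ _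
  | framing_braid i hi j =>
      simpa [YH.inclGen, strandSwap_castSucc] using YH.framing_braid i _ j.castSucc
  | framing_pow j => simpa [YH.inclGen] using YH.framing_pow _
  | quadratic i hi =>
      simp only [map_add, map_mul, map_pow, map_smul, map_one, he, FreeAlgebra.lift_ι_apply]
      exact YH.quadratic i _

/-- The embedding `Y_{d,n}(u) → Y_{d,n+1}(u)` that adds a strand on the right. -/
def YH.incl (d : ℕ) (u : ℂ) (n : ℕ) : YH d u n →ₐ[ℂ] YH d u (n + 1) :=
  RingQuot.liftAlgHom ℂ ⟨FreeAlgebra.lift ℂ (YH.inclGen d u n), YH.inclGen_rel d u n⟩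

/-! ### The trace -/

/-- `tr` is the Juyumaya trace with parameters `z` and `x_1, …, x_{d-1}` (the values of `x` at
the nonzero residues): a linear functional on the inductive limit of the `Y_{d,n}(u)`, given by
a compatible family, with the trace property and the two Markov rules. -/
structure IsJuyumayaTrace (d : ℕ) (u z : ℂ) (x : ZMod d → ℂ)
    (tr : ∀ n, YH d u n →ₗ[ℂ] ℂ) : Prop where
  compatible : ∀ n (a : YH d u n), tr (n + 1) (YH.incl d u n a) = tr n a
  one : ∀ n, tr n 1 = 1
  mul_comm : ∀ n (a b : YH d u n), tr n (a * b) = tr n (b * a)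
  braiding : ∀ n (a : YH d u (n + 1)),
    tr (n + 2) (YH.incl d u (n + 1) a * YH.g n (Nat.lt_succ_self _)) = z * tr (n + 1) a
  framing : ∀ n (a : YH d u n) (m : ℕ), 1 ≤ m → m < d →
    tr (n + 1) (YH.incl d u n a * YH.t (Fin.last n) ^ m) = x (m : ZMod d) * tr n a

/-! ### The framization of the Temperley--Lieb algebra -/

/-- `g_{i,i+1} = g_i g_{i+1} g_i + g_{i+1} g_i + g_i g_{i+1} + g_i + g_{i+1} + 1`. -/
def YH.steinberg {d : ℕ} {u : ℂ} {n : ℕ} (i : ℕ) (hi : i + 2 < n) : YH d u n :=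
  let a : YH d u n := YH.g i (Nat.lt_of_succ_lt hi)
  let b : YH d u n := YH.g (i + 1) hi
  a * b * a + b * a + a * b + a + b + 1

/-- `r_{i,i+1} = ∑_{α+β+γ=0} t_i^α t_{i+1}^β t_{i+2}^γ g_{i,i+1}`, where `α, β, γ` run over the
residues modulo `d`. -/
def YH.r {d : ℕ} [NeZero d] {u : ℂ} {n : ℕ} (i : ℕ) (hi : i + 2 < n) : YH d u n :=
  (∑ α : ZMod d, ∑ β : ZMod d,
    YH.t ⟨i, Nat.lt_of_succ_lt (Nat.lt_of_succ_lt hi)⟩ ^ α.val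
      * YH.t ⟨i + 1, Nat.lt_of_succ_lt hi⟩ ^ β.val
      * YH.t ⟨i + 2, hi⟩ ^ (-α - β).val) * YH.steinberg i hi

/-- The two-sided ideal of `Y_{d,n}(u)` generated by all the `r_{i,i+1}`. -/
def ftlIdeal (d : ℕ) [NeZero d] (u : ℂ) (n : ℕ) : TwoSidedIdeal (YH d u n) :=
  TwoSidedIdeal.span {a | ∃ (i : ℕ) (hi : i + 2 < n), a = YH.r i hi}

/-- The framization of the Temperley--Lieb algebra, `FTL_{d,n}(u)`. -/
abbrev FTL (d : ℕ) [NeZero d] (u : ℂ) (n : ℕ) : Type := (ftlIdeal d u n).ringCon.Quotient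

/-- The quotient map `Y_{d,n}(u) → FTL_{d,n}(u)`. -/
def FTL.mk (d : ℕ) [NeZero d] (u : ℂ) (n : ℕ) : YH d u n →+* FTL d u n :=
  (ftlIdeal d u n).ringCon.mk'

/-- The Juyumaya trace with parameters `z` and `x` passes to `FTL_{d,n}(u)`. -/
def TracePasses (d : ℕ) [NeZero d] (u : ℂ) (n : ℕ) (z : ℂ) (x : ZMod d → ℂ) : Prop :=
  ∃ tr : ∀ n, YH d u n →ₗ[ℂ] ℂ, IsJuyumayaTrace d u z x tr ∧
    ∃ φ : FTL d u n →ₗ[ℂ] ℂ, ∀ a, φ (FTL.mk d u n a) = tr n a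

/-! ### The E-system -/

/-- `E^{(m)} = (1/d) ∑_{s=0}^{d-1} x_{m+s} x_{d-s}`, with indices modulo `d`. -/
def EVal {d : ℕ} [NeZero d] (x : ZMod d → ℂ) (m : ZMod d) : ℂ :=
  (d : ℂ)⁻¹ * ∑ s : ZMod d, x (m + s) * x (-s)

/-- `x` (with `x_0 = 1`) solves the E-system `E^{(m)} = x_m E^{(0)}`, `1 ≤ m ≤ d - 1`. -/
def IsESolution {d : ℕ} [NeZero d] (x : ZMod d → ℂ) : Prop :=
  x 0 = 1 ∧ ∀ m : ZMod d, m ≠ 0 → EVal x m = x m * EVal x 0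

/-- The solution of the E-system parametrized by `D`: `x_m = (1/|D|) ∑_{k ∈ D} exp(2πikm/d)`. -/
def eSolution {d : ℕ} [NeZero d] (D : Finset (ZMod d)) (m : ZMod d) : ℂ :=
  (D.card : ℂ)⁻¹ * ∑ k ∈ D, ZMod.stdAddChar (k * m)

open Classical in
/-- `D_1`: the part of the support of the Fourier transform `y` of `x` on which `y_k = -dz`. -/
def setD₁ {d : ℕ} [NeZero d] (z : ℂ) (x : ZMod d → ℂ) : Finset (ZMod d) :=
  {k | ZMod.dft x k ≠ 0 ∧ ZMod.dft x k = -(d * z)}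

open Classical in
/-- `D_2`: the part of the support of the Fourier transform `y` of `x` on which
`y_k = -dz(u+1)`. -/
def setD₂ {d : ℕ} [NeZero d] (u z : ℂ) (x : ZMod d → ℂ) : Finset (ZMod d) :=
  {k | ZMod.dft x k ≠ 0 ∧ ZMod.dft x k = -(d * z * (u + 1))}

/-! ### Framed braids -/

/-- A generator as an element of the free group. -/
abbrev gσ {n : ℕ} (i : ℕ) (hi : i + 1 < n) : FreeGroup (Gen n) := FreeGroup.of (Gen.g i hi)

/-- A generator as an element of the free group. -/
abbrev gτ {n : ℕ} (j : Fin n) : FreeGroup (Gen n) := FreeGroup.of (Gen.t j)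

/-- The defining relations of the framed braid group on `n` strands. -/
inductive FramedBraidRel (n : ℕ) : FreeGroup (Gen n) → FreeGroup (Gen n) → Prop
  | far (i j : ℕ) (hi : i + 1 < n) (hj : j + 1 < n) (hij : i + 1 < j) :
      FramedBraidRel n (gσ i hi * gσ j hj) (gσ j hj * gσ i hi)
  | braid (i : ℕ) (hi : i + 1 < n) (hj : i + 1 + 1 < n) :
      FramedBraidRel n (gσ i hi * gσ (i + 1) hj * gσ i hi)
        (gσ (i + 1) hj * gσ i hi * gσ (i + 1) hj)
  | framing_comm (i j : Fin n) : FramedBraidRel n (gτ i * gτ j) (gτ j * gτ i)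
  | framing_braid (i : ℕ) (hi : i + 1 < n) (j : Fin n) :
      FramedBraidRel n (gτ j * gσ i hi) (gσ i hi * gτ (strandSwap i hi j))

/-- The framed braid group `F_n`. -/
abbrev FramedBraidGroup (n : ℕ) : Type :=
  PresentedGroup {w : FreeGroup (Gen n) | ∃ a b, FramedBraidRel n a b ∧ w = a * b⁻¹}

/-- The homomorphism from `F_n` given by a map on generators that respects the relations. -/
def FramedBraidGroup.lift {n : ℕ} {G : Type*} [Group G] (f : Gen n → G)
    (h : ∀ a b, FramedBraidRel n a b → FreeGroup.lift f a = FreeGroup.lift f b) :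
    FramedBraidGroup n →* G :=
  PresentedGroup.toGroup (f := f) (by
    rintro w ⟨a, b, hab, rfl⟩
    rw [map_mul, map_inv, h a b hab, mul_inv_cancel])

/-- The braiding generator `σ_i` of `F_n`. -/
def FramedBraidGroup.σ {n : ℕ} (i : ℕ) (hi : i + 1 < n) : FramedBraidGroup n :=
  PresentedGroup.of (Gen.g i hi)

/-- The framing generator `t_j` of `F_n`. -/
def FramedBraidGroup.t {n : ℕ} (j : Fin n) : FramedBraidGroup n :=
  PresentedGroup.of (Gen.t j)

lemma FramedBraidGroup.rel {n : ℕ} {a b : FreeGroup (Gen n)} (h : FramedBraidRel n a b) :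
    (PresentedGroup.mk _ a : FramedBraidGroup n) = PresentedGroup.mk _ b :=
  (PresentedGroup.mk_eq_mk_of_mul_inv_mem ⟨a, b, h, rfl⟩)

/-- The images of the generators under the embedding `F_n → F_{n+1}`. -/
def FramedBraidGroup.inclGen (n : ℕ) : Gen n → FramedBraidGroup (n + 1)
  | Gen.g i hi => FramedBraidGroup.σ i (Nat.lt_succ_of_lt hi)
  | Gen.t j => FramedBraidGroup.t j.castSucc

/-- The embedding `F_n → F_{n+1}` that adds a strand with framing `0` on the right. -/
def FramedBraidGroup.incl (n : ℕ) : FramedBraidGroup n →* FramedBraidGroup (n + 1) :=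
  FramedBraidGroup.lift (FramedBraidGroup.inclGen n) (by
    intro a b h
    cases h with
    | far i j hi hj hij =>
        have h := FramedBraidGroup.rel (.far i j (Nat.lt_succ_of_lt hi) (Nat.lt_succ_of_lt hj) hij)
        simp only [map_mul] at h
        simp only [map_mul, FreeGroup.lift_apply_of]
        exact h
    | braid i hi hj =>
        have h := FramedBraidGroup.rel (.braid i (Nat.lt_succ_of_lt hi) (Nat.lt_succ_of_lt hj))
        simp only [map_mul] at h
        simp only [map_mul, FreeGroup.lift_apply_of]
        exact h
    | framing_comm i j =>
        have h := FramedBraidGroup.rel (.framing_comm i.castSucc j.castSucc)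
        simp only [map_mul] at h
        simp only [map_mul, FreeGroup.lift_apply_of]
        exact h
    | framing_braid i hi j =>
        have h := FramedBraidGroup.rel (.framing_braid i (Nat.lt_succ_of_lt hi) j.castSucc)
        rw [← strandSwap_castSucc i hi] at h
        simp only [map_mul] at h
        simp only [map_mul, FreeGroup.lift_apply_of]
        exact h)

/-- The algebraic sum `ε(α)` of the exponents of the `σ_i` in a framed braid `α`. -/
def FramedBraidGroup.exponent (n : ℕ) : FramedBraidGroup n →* Multiplicative ℤ :=
  FramedBraidGroup.lift
    (fun a => match a with
      | Gen.g _ _ => Multiplicative.ofAdd 1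
      | Gen.t _ => 1)
    (by intro a b h; cases h <;> simp [mul_comm])

/-! ### The representation of framed braids in `Y_{d,n}(u)` -/

section inverses

variable {d : ℕ} {u : ℂ} {n : ℕ}

lemma framingAverage_comm {A : Type*} [Ring A] [Algebra ℂ A] (a b : A)
    (hab : a * b = b * a) (ha : a ^ d = 1) (hb : b ^ d = 1) :
    framingAverage d a b = framingAverage d b a := by
  have hc : Commute a b := hab
  unfold framingAverage
  congr 1
  have h1 : ∑ s ∈ Finset.range d, b ^ s * a ^ (d - s)
      = ∑ s ∈ Finset.range d, a ^ (s + 1) * b ^ (d - (s + 1)) := by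
    rw [← Finset.sum_range_reflect]
    refine Finset.sum_congr rfl fun s hs => ?_
    have hs' : s < d := Finset.mem_range.mp hs
    rw [show d - 1 - s = d - (s + 1) by omega, show d - (d - (s + 1)) = s + 1 by omega]
    exact ((hc.pow_pow _ _).eq).symm
  have h2 := Finset.sum_range_succ (fun s => a ^ s * b ^ (d - s)) d
  have h3 := Finset.sum_range_succ' (fun s => a ^ s * b ^ (d - s)) d
  rw [h1]
  rw [h2] at h3
  simpa [ha, hb] using h3

lemma mul_framingAverage {A : Type*} [Ring A] [Algebra ℂ A] (a b : A)
    (hab : a * b = b * a) (ha : a ^ d = 1) (hb : b ^ d = 1) :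
    a * framingAverage d a b = b * framingAverage d a b := by
  have hc : Commute a b := hab
  unfold framingAverage
  rw [mul_smul_comm, mul_smul_comm]
  congr 1
  rw [Finset.mul_sum, Finset.mul_sum]
  have h2 := Finset.sum_range_succ (fun s => a ^ s * b ^ (d + 1 - s)) d
  have h3 := Finset.sum_range_succ' (fun s => a ^ s * b ^ (d + 1 - s)) d
  rw [h2] at h3
  have h4 : ∑ s ∈ Finset.range d, a * (a ^ s * b ^ (d - s))
      = ∑ s ∈ Finset.range d, a ^ (s + 1) * b ^ (d + 1 - (s + 1)) := by
    refine Finset.sum_congr rfl fun s _ => ?_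
    rw [← mul_assoc, ← pow_succ', Nat.add_sub_add_right]
  have h5 : ∑ s ∈ Finset.range d, b * (a ^ s * b ^ (d - s))
      = ∑ s ∈ Finset.range d, a ^ s * b ^ (d + 1 - s) := by
    refine Finset.sum_congr rfl fun s hs => ?_
    have hs' : s < d := Finset.mem_range.mp hs
    rw [← mul_assoc, ← (hc.pow_left s).eq, mul_assoc, ← pow_succ',
      show d - s + 1 = d + 1 - s by omega]
  rw [h4, h5]
  simpa [ha, hb, pow_succ] using h3.symm

lemma framingAverage_idem {A : Type*} [Ring A] [Algebra ℂ A] [NeZero d] (a b : A)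
    (hab : a * b = b * a) (ha : a ^ d = 1) (hb : b ^ d = 1) :
    framingAverage d a b * framingAverage d a b = framingAverage d a b := by
  have hc : Commute a b := hab
  have hm := mul_framingAverage a b hab ha hb
  have hp (s : ℕ) : a ^ s * framingAverage d a b = b ^ s * framingAverage d a b := by
    induction s with
    | zero => simp
    | succ k ih =>
        rw [pow_succ, mul_assoc, hm, ← mul_assoc, (hc.pow_left k).eq, mul_assoc, ih,
          ← mul_assoc, ← pow_succ']
  have key : ∀ s ∈ Finset.range d,
      a ^ s * b ^ (d - s) * framingAverage d a b = framingAverage d a b := by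
    intro s hs
    have hs' : s < d := Finset.mem_range.mp hs
    rw [(hc.pow_pow s (d - s)).eq, mul_assoc, hp, ← mul_assoc, ← pow_add,
      show d - s + s = d by omega, hb, one_mul]
  conv_lhs => enter [1]; unfold framingAverage
  rw [smul_mul_assoc, Finset.sum_mul, Finset.sum_congr rfl key, Finset.sum_const,
    Finset.card_range, ← Nat.cast_smul_eq_nsmul ℂ, smul_smul,
    inv_mul_cancel₀ (Nat.cast_ne_zero.mpr (NeZero.ne d)), one_smul]

lemma YH.e_idem [NeZero d] (i : ℕ) (hi : i + 1 < n) :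
    (YH.e i hi * YH.e i hi : YH d u n) = YH.e i hi :=
  framingAverage_idem _ _ (YH.framing_comm _ _) (YH.framing_pow _) (YH.framing_pow _)

lemma YH.e_comm_g (i : ℕ) (hi : i + 1 < n) :
    (YH.e i hi * YH.g i hi : YH d u n) = YH.g i hi * YH.e i hi := by
  have ht : SemiconjBy (YH.g i hi : YH d u n)
      (YH.t ⟨i + 1, hi⟩) (YH.t ⟨i, Nat.lt_of_succ_lt hi⟩) := by
    have h := YH.framing_braid (d := d) (u := u) i hi ⟨i, Nat.lt_of_succ_lt hi⟩
    rw [strandSwap, Equiv.swap_apply_left] at h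
    exact h.symm
  have ht' : SemiconjBy (YH.g i hi : YH d u n)
      (YH.t ⟨i, Nat.lt_of_succ_lt hi⟩) (YH.t ⟨i + 1, hi⟩) := by
    have h := YH.framing_braid (d := d) (u := u) i hi ⟨i + 1, hi⟩
    rw [strandSwap, Equiv.swap_apply_right] at h
    exact h.symm
  have h : (YH.e i hi * YH.g i hi : YH d u n)
      = YH.g i hi * framingAverage d (YH.t ⟨i + 1, hi⟩) (YH.t ⟨i, Nat.lt_of_succ_lt hi⟩) := by
    rw [YH.e, framingAverage, framingAverage, smul_mul_assoc, mul_smul_comm, Finset.sum_mul,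
      Finset.mul_sum]
    congr 1
    exact Finset.sum_congr rfl fun s _ =>
      (((ht.pow_right s).mul_right (ht'.pow_right (d - s))).eq).symm
  rw [h, framingAverage_comm _ _ (YH.framing_comm _ _) (YH.framing_pow _) (YH.framing_pow _)]
  rfl

/-- The inverse `g_i + (u⁻¹ - 1) e_i + (u⁻¹ - 1) e_i g_i` of `g_i`. -/
def YH.gInv (i : ℕ) (hi : i + 1 < n) : YH d u n :=
  YH.g i hi + (u⁻¹ - 1) • YH.e i hi + (u⁻¹ - 1) • (YH.e i hi * YH.g i hi)

lemma YH.gInv_comm (i : ℕ) (hi : i + 1 < n) :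
    (YH.gInv i hi * YH.g i hi : YH d u n) = YH.g i hi * YH.gInv i hi := by
  have h := YH.e_comm_g (d := d) (u := u) i hi
  simp only [YH.gInv, add_mul, mul_add, smul_mul_assoc, mul_smul_comm]
  rw [← mul_assoc, ← h]

lemma YH.g_mul_gInv [NeZero d] (hu : u ≠ 0) (i : ℕ) (hi : i + 1 < n) :
    (YH.g i hi * YH.gInv i hi : YH d u n) = 1 := by
  have h := YH.e_comm_g (d := d) (u := u) i hi
  have hq := YH.quadratic (d := d) (u := u) i hi
  have he := YH.e_idem (d := d) (u := u) i hi
  set g : YH d u n := YH.g i hi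
  set e : YH d u n := YH.e i hi
  have h1 : g * (e * g) = e + (u - 1) • e + (u - 1) • (e * g) := by
    rw [← mul_assoc, ← h, mul_assoc, ← sq, hq, mul_add, mul_add, mul_one, mul_smul_comm,
      mul_smul_comm, he, ← mul_assoc, he]
  have hg : (YH.gInv i hi : YH d u n) = g + (u⁻¹ - 1) • e + (u⁻¹ - 1) • (e * g) := rfl
  rw [hg, mul_add, mul_add, mul_smul_comm, mul_smul_comm, h1, ← h, ← sq, hq]
  have hu' : u * u⁻¹ = 1 := mul_inv_cancel₀ hu
  match_scalars
  · simp
  · linear_combination hu'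
  · linear_combination hu'

end inverses

/-- The images of the generators of `F_n`, as units of `Y_{d,n}(u)`. -/
def YH.unitGen {d : ℕ} [NeZero d] {u : ℂ} (hu : u ≠ 0) (n : ℕ) : Gen n → (YH d u n)ˣ
  | Gen.g i hi => ⟨YH.g i hi, YH.gInv i hi, YH.g_mul_gInv hu i hi,
      (YH.gInv_comm i hi).trans (YH.g_mul_gInv hu i hi)⟩
  | Gen.t j => Units.ofPowEqOne (YH.t j) d (YH.framing_pow j) (NeZero.ne d)

/-- The representation `γ : F_n → Y_{d,n}(u)`, `σ_i ↦ g_i`, `t_j ↦ t_j`. -/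
def gammaRep {d : ℕ} [NeZero d] {u : ℂ} (hu : u ≠ 0) (n : ℕ) :
    FramedBraidGroup n →* (YH d u n)ˣ :=
  FramedBraidGroup.lift (YH.unitGen hu n) (by
    intro a b h
    apply Units.ext
    cases h with
    | far i j hi hj hij => simpa [YH.unitGen] using YH.far i j hi hj hij
    | braid i hi hj => simpa [YH.unitGen] using YH.braid i hi hj
    | framing_comm i j => simpa [YH.unitGen] using YH.framing_comm i j
    | framing_braid i hi j => simpa [YH.unitGen] using YH.framing_braid i hi j)

/-! ### Framed links and the invariant `Γ_D` -/

/-- The elementary moves of framed braid equivalence on the framed braids with at least one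
strand: conjugation, and positive and negative stabilization. -/
inductive FramedMarkovMove :
    (Σ n : ℕ, FramedBraidGroup (n + 1)) → (Σ n : ℕ, FramedBraidGroup (n + 1)) → Prop
  | conj (n : ℕ) (α β : FramedBraidGroup (n + 1)) :
      FramedMarkovMove ⟨n, β * α * β⁻¹⟩ ⟨n, α⟩
  | stabPos (n : ℕ) (α : FramedBraidGroup (n + 1)) :
      FramedMarkovMove
        ⟨n + 1, FramedBraidGroup.incl (n + 1) α * FramedBraidGroup.σ n (Nat.lt_succ_self _)⟩
        ⟨n, α⟩
  | stabNeg (n : ℕ) (α : FramedBraidGroup (n + 1)) :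
      FramedMarkovMove
        ⟨n + 1, FramedBraidGroup.incl (n + 1) α * (FramedBraidGroup.σ n (Nat.lt_succ_self _))⁻¹⟩
        ⟨n, α⟩

/-- Oriented framed links up to isotopy, as closures of framed braids up to framed braid
equivalence (the equivalence relation generated by the moves). -/
def FramedLink : Type := Quot FramedMarkovMove

/-- The closure of a framed braid on `n + 1` strands. -/
def braidClosure {n : ℕ} (α : FramedBraidGroup (n + 1)) : FramedLink := Quot.mk _ ⟨n, α⟩

/-- `λ_D = (|D| z + 1 - u) / (|D| u z)`. -/
def lambdaD {d : ℕ} (u z : ℂ) (D : Finset (ZMod d)) : ℂ :=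
  (D.card * z + 1 - u) / (D.card * u * z)

/-- The value `P^{N-1} s^{ε(α)} tr(γ(α))`, `P = 1/(z s)`, on a framed braid `α` with `N = n + 1`
strands, where `s` is a chosen square root of `λ_D`. -/
def gammaValue {d : ℕ} [NeZero d] {u : ℂ} (hu : u ≠ 0) (z s : ℂ)
    (tr : ∀ n, YH d u n →ₗ[ℂ] ℂ) {n : ℕ} (α : FramedBraidGroup (n + 1)) : ℂ :=
  (1 / (z * s)) ^ n * s ^ (Multiplicative.toAdd (FramedBraidGroup.exponent (n + 1) α))
    * tr (n + 1) ((gammaRep hu (n + 1) α : (YH d u (n + 1))ˣ) : YH d u (n + 1))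

end

end FramizationTL

open FramizationTL

namespace FramizationTL

noncomputable section

/-! ### The embedding on generators, and generation -/

section generation

variable {d : ℕ} {u : ℂ} {n : ℕ}

/-! Uniqueness of the trace is Jones' argument. On `n + 2` strands the algebra is spanned by the
words a t^m and a g b, with a and b on one strand fewer and t, g the last generators
(`wordSpan_eq_top`). The Markov rules and cyclicity then determine the functional by induction on
the number of strands.

Existence is needed only at the special parameters, so no general construction is made. Letters
consist of a residue modulo d and one of two states. On functions of words of length n, t_j acts by
the character of the j-th residue. The generator g_i exchanges letters of different residues and
acts by the Hecke R-matrix on letters of the same residue, so that e_i is the projection onto equal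
residues (`wordRep`). The matrix trace weighted by a product of one-letter weights is cyclic. Its
partial trace over the last letter gives the Markov rules as soon as the weights satisfy
`IsMarkovWeight`. Two explicit choices of weights, supported on the residues in D, give the two
families of traces.

These traces pass because the whole representation kills r_{i,i+1}. The sum over α + β + γ = 0 is a
multiple of the projection onto words with three equal residues. There the six-term sum vanishes,
since g acts by -1 on two equal letters and three letters cannot be distinct when there are two
states. This is the quantum form of the vanishing of the third exterior power of a plane
(`steinberg_coeff`, `wordRep_r`).

Conversely, let the trace vanish on the ideal. Evaluating it on t_0^S r_{0,1} for every residue S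
and taking the Fourier transform in S gives, for each y = y_k, the cubic y (y + dz)(y + dz(u + 1)) =
0 (`IsJuyumayaTrace.tr_three`, `sum_fourier_cubic`, `dft_of_tracePasses`). The Fourier transform
turns the E-system into y_k^2 = C y_k, so its solutions are the x for which y is constant on its
support. When one of the two nonzero values does not occur, y has this form, and x_0 = 1 fixes z.

For the invariant, the same model gives tr(a e) = tr(a)/|D|. With z = -1/((u + 1)|D|) this yields
tr(a g⁻¹) = zu tr(a), which is what the normalization by a square root of u requires. -/

lemma YH.incl_g (i : ℕ) (hi : i + 1 < n) :
    YH.incl d u n (YH.g i hi) = YH.g i (Nat.lt_succ_of_lt hi) := by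
  simp [YH.incl, YH.g, YH.mk, YH.inclGen]

lemma YH.incl_t (j : Fin n) : YH.incl d u n (YH.t j) = YH.t j.castSucc := by
  simp [YH.incl, YH.t, YH.mk, YH.inclGen]

/-- A subalgebra that contains the generators is everything. -/
lemma YH.subalgebra_eq_top (S : Subalgebra ℂ (YH d u n))
    (hg : ∀ i hi, YH.g i hi ∈ S) (ht : ∀ j, YH.t j ∈ S) : S = ⊤ := by
  refine Algebra.eq_top_iff.mpr fun a => ?_
  obtain ⟨b, rfl⟩ := RingQuot.mkAlgHom_surjective ℂ (YHRel d u n) a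
  change YH.mk d u n b ∈ S
  induction b using FreeAlgebra.induction with
  | grade0 r => rw [AlgHom.commutes]; exact S.algebraMap_mem r
  | grade1 x =>
      cases x with
      | g i hi => exact hg i hi
      | t j => exact ht j
  | mul a b ha hb => rw [map_mul]; exact S.mul_mem ha hb
  | add a b ha hb => rw [map_add]; exact S.add_mem ha hb

/-- A subspace that contains `1` and is stable under right multiplication by the generators is
everything. -/
lemma YH.submodule_eq_top (W : Submodule ℂ (YH d u n)) (h1 : 1 ∈ W)
    (hg : ∀ i hi, ∀ a ∈ W, a * YH.g i hi ∈ W) (ht : ∀ j, ∀ a ∈ W, a * YH.t j ∈ W) : W = ⊤ := by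
  let S : Subalgebra ℂ (YH d u n) :=
    { carrier := {b | ∀ a ∈ W, a * b ∈ W}
      mul_mem' := fun {b c} hb hc a ha => by rw [← mul_assoc]; exact hc _ (hb _ ha)
      add_mem' := fun {b c} hb hc a ha => by rw [mul_add]; exact W.add_mem (hb _ ha) (hc _ ha)
      algebraMap_mem' := fun r a ha => by
        rw [← Algebra.commutes, ← Algebra.smul_def]; exact W.smul_mem r ha }
  have hS : S = ⊤ := YH.subalgebra_eq_top S hg ht
  refine eq_top_iff.mpr fun a _ => ?_
  have ha : a ∈ S := hS ▸ Algebra.mem_top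
  simpa using ha 1 h1

/-- The centralizer of an element is everything as soon as it contains the generators. -/
lemma YH.commute_incl {b : YH d u (n + 1)}
    (hg : ∀ i (hi : i + 1 < n), Commute b (YH.g i (Nat.lt_succ_of_lt hi)))
    (ht : ∀ j : Fin n, Commute b (YH.t j.castSucc)) (a : YH d u n) :
    Commute b (YH.incl d u n a) := by
  let S : Subalgebra ℂ (YH d u n) := (Subalgebra.centralizer ℂ {b}).comap (YH.incl d u n)
  have hS : S = ⊤ := by
    refine YH.subalgebra_eq_top S (fun i hi => ?_) fun j => ?_
    · change YH.incl d u n _ ∈ Subalgebra.centralizer ℂ {b}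
      rw [YH.incl_g, Subalgebra.mem_centralizer_iff]
      rintro _ rfl
      exact hg i hi
    · change YH.incl d u n _ ∈ Subalgebra.centralizer ℂ {b}
      rw [YH.incl_t, Subalgebra.mem_centralizer_iff]
      rintro _ rfl
      exact ht j
  have ha : a ∈ S := hS ▸ Algebra.mem_top
  exact (Subalgebra.mem_centralizer_iff ℂ).mp ha b rfl

lemma strandSwap_of_ne {i : ℕ} (hi : i + 1 < n) (j : Fin n) (h1 : (j : ℕ) ≠ i)
    (h2 : (j : ℕ) ≠ i + 1) : strandSwap i hi j = j :=
  Equiv.swap_apply_of_ne_of_ne (fun h => h1 (by rw [h])) (fun h => h2 (by rw [h]))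

lemma YH.t_commute_g {i : ℕ} (hi : i + 1 < n) (j : Fin n) (h1 : (j : ℕ) ≠ i)
    (h2 : (j : ℕ) ≠ i + 1) : Commute (YH.t j : YH d u n) (YH.g i hi) := by
  have h := YH.framing_braid (d := d) (u := u) i hi j
  rwa [strandSwap_of_ne hi j h1 h2] at h

lemma YH.t_left_mul_g (i : ℕ) (hi : i + 1 < n) :
    (YH.t ⟨i, Nat.lt_of_succ_lt hi⟩ * YH.g i hi : YH d u n) = YH.g i hi * YH.t ⟨i + 1, hi⟩ := by
  rw [YH.framing_braid, strandSwap, Equiv.swap_apply_left]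

lemma YH.t_right_mul_g (i : ℕ) (hi : i + 1 < n) :
    (YH.t ⟨i + 1, hi⟩ * YH.g i hi : YH d u n) = YH.g i hi * YH.t ⟨i, Nat.lt_of_succ_lt hi⟩ := by
  rw [YH.framing_braid, strandSwap, Equiv.swap_apply_right]

lemma YH.t_left_pow_mul_g (i : ℕ) (hi : i + 1 < n) (m : ℕ) :
    (YH.t ⟨i, Nat.lt_of_succ_lt hi⟩ ^ m * YH.g i hi : YH d u n)
      = YH.g i hi * YH.t ⟨i + 1, hi⟩ ^ m :=
  (SemiconjBy.pow_right (show SemiconjBy (YH.g i hi) _ _ from (YH.t_left_mul_g i hi).symm) m).symm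

lemma YH.t_right_pow_mul_g (i : ℕ) (hi : i + 1 < n) (m : ℕ) :
    (YH.t ⟨i + 1, hi⟩ ^ m * YH.g i hi : YH d u n)
      = YH.g i hi * YH.t ⟨i, Nat.lt_of_succ_lt hi⟩ ^ m :=
  (SemiconjBy.pow_right (show SemiconjBy (YH.g i hi) _ _ from (YH.t_right_mul_g i hi).symm) m).symm

/-- It suffices to check the generators of the smaller algebra, none of which touches the last
strand. -/
lemma YH.t_last_commute_incl (a : YH d u n) :
    Commute (YH.t (Fin.last n) : YH d u (n + 1)) (YH.incl d u n a) :=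
  YH.commute_incl
    (fun i hi => YH.t_commute_g _ _ (by simp; omega) (by simp; omega))
    (fun j => YH.framing_comm _ _) a

lemma YH.g_last_commute_incl_incl (a : YH d u n) :
    Commute (YH.g n (Nat.lt_succ_self _) : YH d u (n + 2))
      (YH.incl d u (n + 1) (YH.incl d u n a)) := by
  let S : Subalgebra ℂ (YH d u n) :=
    (Subalgebra.centralizer ℂ {(YH.g n (Nat.lt_succ_self _) : YH d u (n + 2))}).comap
      ((YH.incl d u (n + 1)).comp (YH.incl d u n))
  have hS : S = ⊤ := by
    refine YH.subalgebra_eq_top S (fun i hi => ?_) fun j => ?_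
    · change YH.incl d u (n + 1) (YH.incl d u n _) ∈ Subalgebra.centralizer ℂ _
      rw [YH.incl_g, YH.incl_g, Subalgebra.mem_centralizer_iff]
      rintro _ rfl
      exact (YH.far i n _ _ hi).symm
    · change YH.incl d u (n + 1) (YH.incl d u n _) ∈ Subalgebra.centralizer ℂ _
      rw [YH.incl_t, YH.incl_t, Subalgebra.mem_centralizer_iff]
      rintro _ rfl
      exact (YH.t_commute_g _ _ (by simp; omega) (by simp; omega)).symm.eq
  have ha : a ∈ S := hS ▸ Algebra.mem_top
  exact (Subalgebra.mem_centralizer_iff ℂ).mp ha _ rfl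

end generation

/-! ### The inductive spanning set and uniqueness of the trace -/

section uniqueness

variable {d : ℕ} {u : ℂ}

/-- The elements `a t_{n+1}^m` with `a` on `n` strands. -/
def framingWords (d : ℕ) (u : ℂ) (n : ℕ) : Set (YH d u (n + 1)) :=
  {x | ∃ a m, x = YH.incl d u n a * YH.t (Fin.last n) ^ m}

/-- The elements `a g_n b` with `a`, `b` on `n` strands. -/
def braidingWords (d : ℕ) (u : ℂ) (n : ℕ) : Set (YH d u (n + 2)) :=
  {x | ∃ a b, x = YH.incl d u (n + 1) a * YH.g n (Nat.lt_succ_self _) * YH.incl d u (n + 1) b}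

lemma span_framingWords_one : Submodule.span ℂ (framingWords d u 0) = ⊤ := by
  refine YH.submodule_eq_top _ (Submodule.subset_span ⟨1, 0, by simp⟩)
    (fun i hi => absurd hi (by omega)) fun j a ha => ?_
  obtain rfl : j = Fin.last 0 := Fin.eq_zero j
  induction ha using Submodule.span_induction with
  | mem x hx =>
      obtain ⟨a, m, rfl⟩ := hx
      exact Submodule.subset_span ⟨a, m + 1, by rw [pow_succ, mul_assoc]⟩
  | zero => simp
  | add x y _ _ hx hy => rw [add_mul]; exact Submodule.add_mem _ hx hy
  | smul r x _ hx => rw [smul_mul_assoc]; exact Submodule.smul_mem _ r hx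

/-- The span of the elements `a t^m` and `a g b`. -/
def wordSpan (d : ℕ) (u : ℂ) (n : ℕ) : Submodule ℂ (YH d u (n + 2)) :=
  Submodule.span ℂ (framingWords d u (n + 1) ∪ braidingWords d u n)

lemma framingWord_mem (n : ℕ) (a : YH d u (n + 1)) (m : ℕ) :
    YH.incl d u (n + 1) a * YH.t (Fin.last (n + 1)) ^ m ∈ wordSpan d u n :=
  Submodule.subset_span (Or.inl ⟨a, m, rfl⟩)

lemma braidingWord_mem (n : ℕ) (a b : YH d u (n + 1)) :
    YH.incl d u (n + 1) a * YH.g n (Nat.lt_succ_self _) * YH.incl d u (n + 1) b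
      ∈ wordSpan d u n :=
  Submodule.subset_span (Or.inr ⟨a, b, rfl⟩)

lemma wordSpan_mul_incl {n : ℕ} {x : YH d u (n + 2)} (hx : x ∈ wordSpan d u n)
    (c : YH d u (n + 1)) : x * YH.incl d u (n + 1) c ∈ wordSpan d u n := by
  induction hx using Submodule.span_induction with
  | mem x hx =>
      obtain ⟨a, m, rfl⟩ | ⟨a, b, rfl⟩ := hx
      · rw [mul_assoc, ((YH.t_last_commute_incl c).pow_left m).eq, ← mul_assoc, ← map_mul]
        exact framingWord_mem n _ m
      · rw [mul_assoc, ← map_mul]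
        exact braidingWord_mem n _ _
  | zero => simp
  | add x y _ _ hx hy => rw [add_mul]; exact Submodule.add_mem _ hx hy
  | smul r x _ hx => rw [smul_mul_assoc]; exact Submodule.smul_mem _ r hx

lemma incl_mul_wordSpan {n : ℕ} {x : YH d u (n + 2)} (hx : x ∈ wordSpan d u n)
    (c : YH d u (n + 1)) : YH.incl d u (n + 1) c * x ∈ wordSpan d u n := by
  induction hx using Submodule.span_induction with
  | mem x hx =>
      obtain ⟨a, m, rfl⟩ | ⟨a, b, rfl⟩ := hx
      · rw [← mul_assoc, ← map_mul]
        exact framingWord_mem n _ m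
      · rw [← mul_assoc, ← mul_assoc, ← map_mul]
        exact braidingWord_mem n _ _
  | zero => simp
  | add x y _ _ hx hy => rw [mul_add]; exact Submodule.add_mem _ hx hy
  | smul r x _ hx => rw [mul_smul_comm]; exact Submodule.smul_mem _ r hx

lemma YH.t_prev (n : ℕ) :
    YH.incl d u (n + 1) (YH.t (Fin.last n)) = YH.t ⟨n, Nat.lt_succ_of_lt (Nat.lt_succ_self n)⟩ :=
  YH.incl_t _

/-- In a g b t the last framing generator commutes with b and then passes g leftwards, becoming the
framing generator of the previous strand, which is absorbed into a. -/
lemma wordSpan_mul_t_last {n : ℕ} {x : YH d u (n + 2)} (hx : x ∈ wordSpan d u n) :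
    x * YH.t (Fin.last (n + 1)) ∈ wordSpan d u n := by
  induction hx using Submodule.span_induction with
  | mem x hx =>
      obtain ⟨a, m, rfl⟩ | ⟨a, b, rfl⟩ := hx
      · rw [mul_assoc, ← pow_succ]
        exact framingWord_mem n _ _
      · rw [mul_assoc, ← (YH.t_last_commute_incl b).eq, ← mul_assoc,
          mul_assoc (YH.incl d u (n + 1) a)]
        have h := YH.t_left_mul_g (d := d) (u := u) n (Nat.lt_succ_self (n + 1))
        rw [← YH.t_prev] at h
        rw [show (Fin.last (n + 1)) = ⟨n + 1, Nat.lt_succ_self (n + 1)⟩ from rfl, ← h, ← mul_assoc,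
          ← map_mul]
        exact braidingWord_mem n _ _
  | zero => simp
  | add x y _ _ hx hy => rw [add_mul]; exact Submodule.add_mem _ hx hy
  | smul r x _ hx => rw [smul_mul_assoc]; exact Submodule.smul_mem _ r hx

lemma t_last_pow_mul_g_mem (n m : ℕ) :
    (YH.t (Fin.last (n + 1)) ^ m * YH.g n (Nat.lt_succ_self _) : YH d u (n + 2))
      ∈ wordSpan d u n := by
  rw [show (Fin.last (n + 1)) = ⟨n + 1, Nat.lt_succ_self (n + 1)⟩ from rfl,
    YH.t_right_pow_mul_g, ← YH.t_prev]
  simpa using braidingWord_mem (d := d) (u := u) n 1 (YH.t (Fin.last n) ^ m)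

lemma e_last_mem (n : ℕ) : (YH.e n (Nat.lt_succ_self _) : YH d u (n + 2)) ∈ wordSpan d u n := by
  rw [YH.e, framingAverage, ← YH.t_prev]
  refine Submodule.smul_mem _ _ (Submodule.sum_mem _ fun s _ => ?_)
  rw [← map_pow]
  exact framingWord_mem n _ _

lemma e_last_mul_g_mem (n : ℕ) :
    (YH.e n (Nat.lt_succ_self _) * YH.g n (Nat.lt_succ_self _) : YH d u (n + 2))
      ∈ wordSpan d u n := by
  rw [YH.e, framingAverage, ← YH.t_prev, smul_mul_assoc, Finset.sum_mul]
  refine Submodule.smul_mem _ _ (Submodule.sum_mem _ fun s _ => ?_)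
  rw [← map_pow, mul_assoc]
  exact incl_mul_wordSpan (t_last_pow_mul_g_mem n _) _

lemma g_last_sq_mem (n : ℕ) :
    (YH.g n (Nat.lt_succ_self _) * YH.g n (Nat.lt_succ_self _) : YH d u (n + 2))
      ∈ wordSpan d u n := by
  rw [← sq, YH.quadratic]
  refine Submodule.add_mem _ (Submodule.add_mem _ ?_ (Submodule.smul_mem _ _ (e_last_mem n)))
    (Submodule.smul_mem _ _ (e_last_mul_g_mem n))
  simpa using framingWord_mem (d := d) (u := u) n 1 0

lemma wordSpan_mul_t_last_pow {n : ℕ} (m : ℕ) {x : YH d u (n + 2)} (hx : x ∈ wordSpan d u n) :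
    x * YH.t (Fin.last (n + 1)) ^ m ∈ wordSpan d u n := by
  induction m with
  | zero => simpa using hx
  | succ m ih => rw [pow_succ, ← mul_assoc]; exact wordSpan_mul_t_last ih

/-- For b = a t^m with a two strands below, both a and t^m can be moved outside the two copies of g,
which leaves g², handled by the quadratic relation. -/
lemma g_framingWord_g_mem (n : ℕ) {b : YH d u (n + 1)} (hb : b ∈ framingWords d u n) :
    YH.g n (Nat.lt_succ_self _) * YH.incl d u (n + 1) b * YH.g n (Nat.lt_succ_self _)
      ∈ wordSpan d u n := by
  obtain ⟨a, m, rfl⟩ := hb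
  rw [map_mul, map_pow, YH.t_prev, ← mul_assoc, (YH.g_last_commute_incl_incl a).eq, mul_assoc,
    YH.t_left_pow_mul_g, ← mul_assoc, mul_assoc (YH.incl d u (n + 1) _)]
  exact wordSpan_mul_t_last_pow m (incl_mul_wordSpan (g_last_sq_mem n) _)

/-- The outer factors of b commute with the new generator, and the braid relation turns the middle
into a word in which that generator occurs only once. -/
lemma g_braidingWord_g_mem (n : ℕ) {b : YH d u (n + 2)} (hb : b ∈ braidingWords d u n) :
    YH.g (n + 1) (Nat.lt_succ_self _) * YH.incl d u (n + 2) b * YH.g (n + 1) (Nat.lt_succ_self _)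
      ∈ wordSpan d u (n + 1) := by
  obtain ⟨a, c, rfl⟩ := hb
  rw [map_mul, map_mul, YH.incl_g]
  have h1 := (YH.g_last_commute_incl_incl a).eq
  have h2 := (YH.g_last_commute_incl_incl c).eq
  have hb := YH.braid (d := d) (u := u) n (Nat.lt_succ_of_lt (Nat.lt_succ_self (n + 1)))
    (Nat.lt_succ_self (n + 2))
  have h : ∀ A C G H : YH d u (n + 3), G * A = A * G → G * C = C * G → H * G * H = G * H * G →
      G * (A * H * C) * G = A * H * G * (H * C) := by
    intro A C G H hA hC hH
    calc G * (A * H * C) * G = (G * A) * H * (C * G) := by simp only [mul_assoc]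
      _ = A * (G * H * G) * C := by rw [hA, ← hC]; simp only [mul_assoc]
      _ = A * H * G * (H * C) := by rw [← hH]; simp only [mul_assoc]
  rw [h _ _ _ _ h1 h2 hb, ← YH.incl_g n (Nat.lt_succ_self (n + 1)), ← map_mul, ← map_mul]
  exact braidingWord_mem (n + 1) _ _

lemma wordSpan_eq_top (n : ℕ) : wordSpan d u n = ⊤ := by
  -- Stability under right multiplication by the last braiding generator is the only hard case; it
  -- reduces to the products g b g. By linearity these need to be checked only for b in the spanning
  -- set one level below, which makes the induction run.
  have key : ∀ n, (∀ b : YH d u (n + 1), YH.g n (Nat.lt_succ_self _) * YH.incl d u (n + 1) b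
      * YH.g n (Nat.lt_succ_self _) ∈ wordSpan d u n) → wordSpan d u n = ⊤ := by
    intro n hn
    have hone : (1 : YH d u (n + 2)) ∈ wordSpan d u n := by
      simpa using framingWord_mem (d := d) (u := u) n 1 0
    refine YH.submodule_eq_top _ hone (fun i hi x hx => ?_) fun j x hx => ?_
    · rcases Nat.lt_or_ge (i + 1) (n + 1) with h | h
      · rw [← YH.incl_g i h]
        exact wordSpan_mul_incl hx _
      · obtain rfl : i = n := by omega
        induction hx using Submodule.span_induction with
        | mem x hx =>
            obtain ⟨a, m, rfl⟩ | ⟨a, b, rfl⟩ := hx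
            · rw [mul_assoc]
              exact incl_mul_wordSpan (t_last_pow_mul_g_mem i m) a
            · rw [mul_assoc, mul_assoc, ← mul_assoc (YH.g i _)]
              exact incl_mul_wordSpan (hn b) a
        | zero => simp
        | add x y _ _ hx hy => rw [add_mul]; exact Submodule.add_mem _ hx hy
        | smul r x _ hx => rw [smul_mul_assoc]; exact Submodule.smul_mem _ r hx
    · induction j using Fin.lastCases with
      | last => exact wordSpan_mul_t_last hx
      | cast j => rw [← YH.incl_t]; exact wordSpan_mul_incl hx _
  have span_mem : ∀ n (S : Set (YH d u (n + 1))), Submodule.span ℂ S = ⊤ →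
      (∀ b ∈ S, YH.g n (Nat.lt_succ_self _) * YH.incl d u (n + 1) b
        * YH.g n (Nat.lt_succ_self _) ∈ wordSpan d u n) →
      ∀ b : YH d u (n + 1), YH.g n (Nat.lt_succ_self _) * YH.incl d u (n + 1) b
        * YH.g n (Nat.lt_succ_self _) ∈ wordSpan d u n := by
    intro n S hS h b
    have hb : b ∈ Submodule.span ℂ S := hS ▸ Submodule.mem_top
    induction hb using Submodule.span_induction with
    | mem x hx => exact h x hx
    | zero => simp
    | add x y _ _ hx hy => rw [map_add, mul_add, add_mul]; exact Submodule.add_mem _ hx hy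
    | smul r x _ hx =>
        rw [map_smul, mul_smul_comm, smul_mul_assoc]; exact Submodule.smul_mem _ r hx
  induction n with
  | zero => exact key 0 (span_mem 0 _ span_framingWords_one fun b => g_framingWord_g_mem 0)
  | succ n ih =>
      refine key (n + 1) (span_mem (n + 1) _ ih fun b hb => ?_)
      exact hb.elim (g_framingWord_g_mem (n + 1)) (g_braidingWord_g_mem n)

lemma YH.linearMap_ext_zero {f g : YH d u 0 →ₗ[ℂ] ℂ} (h : f 1 = g 1) : f = g := by
  have hW : LinearMap.eqLocus f g = ⊤ := by
    refine YH.submodule_eq_top _ ?_ (fun i hi => absurd hi (by omega)) fun j => j.elim0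
    exact h
  exact LinearMap.ext fun a => (hW ▸ Submodule.mem_top : a ∈ LinearMap.eqLocus f g)

lemma YH.t_pow_mod {n : ℕ} (j : Fin n) (m : ℕ) : (YH.t j : YH d u n) ^ (m % d) = YH.t j ^ m := by
  conv_rhs => rw [← Nat.mod_add_div m d]
  rw [pow_add, pow_mul, YH.framing_pow, one_pow, mul_one]

variable {z : ℂ} {x : ZMod d → ℂ} {tr tr' : ∀ n, YH d u n →ₗ[ℂ] ℂ}

/-- The framing rule for all exponents. -/
lemma IsJuyumayaTrace.framing_all [NeZero d] (h : IsJuyumayaTrace d u z x tr) (hx : x 0 = 1)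
    {n : ℕ} (a : YH d u n) (m : ℕ) :
    tr (n + 1) (YH.incl d u n a * YH.t (Fin.last n) ^ m) = x (m : ZMod d) * tr n a := by
  -- The Markov rule covers the exponents 1, …, d - 1. The remaining residue 0 is compatibility
  -- together with `x 0 = 1`.
  rw [← YH.t_pow_mod, ← ZMod.natCast_mod m d]
  rcases Nat.eq_zero_or_pos (m % d) with h0 | h0
  · rw [h0, pow_zero, mul_one, h.compatible, Nat.cast_zero, hx, one_mul]
  · exact h.framing n a _ h0 (Nat.mod_lt _ (NeZero.pos d))

/-- On the spanning set the values are forced: the framing rule treats a t^m, and tr(a g b) = tr(b a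
g) = z tr(b a) by cyclicity. -/
theorem IsJuyumayaTrace.unique [NeZero d] (hx : x 0 = 1) (h : IsJuyumayaTrace d u z x tr)
    (h' : IsJuyumayaTrace d u z x tr') : tr = tr' := by
  funext n
  have framing : ∀ n, tr n = tr' n → ∀ b ∈ framingWords d u n, tr (n + 1) b = tr' (n + 1) b := by
    rintro n hn _ ⟨a, m, rfl⟩
    rw [h.framing_all hx, h'.framing_all hx, hn]
  induction n with
  | zero => exact YH.linearMap_ext_zero (by rw [h.one, h'.one])
  | succ n ih =>
      cases n with
      | zero => exact LinearMap.ext_on span_framingWords_one (framing 0 ih)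
      | succ n =>
          refine LinearMap.ext_on (wordSpan_eq_top n) ?_
          rintro b (hb | ⟨a, c, rfl⟩)
          · exact framing (n + 1) ih b hb
          · rw [h.mul_comm, h'.mul_comm, ← mul_assoc, ← map_mul, h.braiding, h'.braiding, ih]

end uniqueness

/-! ### A representation on coloured words -/

section model

/-- Coefficient of the swapped word in the action of a braiding generator. -/
def swapCoeff {d : ℕ} (u : ℂ) (a b : ZMod d × Bool) : ℂ :=
  if a.1 = b.1 then (if a.2 = b.2 then 0 else if b.2 then 1 else u) else 1

/-- Coefficient of the unchanged word in the action of a braiding generator. -/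
def stayCoeff {d : ℕ} (u : ℂ) (a b : ZMod d × Bool) : ℂ :=
  if a.1 = b.1 then (if a.2 = b.2 then -1 else if b.2 then 0 else u - 1) else 0

/-- Functions on words of length `n` in the letters `ZMod d × Bool`. -/
abbrev WordFun (d n : ℕ) : Type := (Fin n → ZMod d × Bool) → ℂ

/-- The Hecke-type `R`-matrix at the places `p`, `q`. -/
def braidOp {d n : ℕ} (u : ℂ) (p q : Fin n) : Module.End ℂ (WordFun d n) where
  toFun f w := swapCoeff u (w p) (w q) * f (w ∘ Equiv.swap p q) + stayCoeff u (w p) (w q) * f w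
  map_add' f g := by ext w; simp only [Pi.add_apply]; ring
  map_smul' c f := by ext w; simp only [Pi.smul_apply, smul_eq_mul, RingHom.id_apply]; ring

/-- Multiplication by a function of the word. -/
def diagOp {d n : ℕ} (c : (Fin n → ZMod d × Bool) → ℂ) : Module.End ℂ (WordFun d n) where
  toFun f w := c w * f w
  map_add' f g := by ext w; simp only [Pi.add_apply]; ring
  map_smul' r f := by ext w; simp only [Pi.smul_apply, smul_eq_mul, RingHom.id_apply]; ring

variable {d : ℕ} {u : ℂ} {n : ℕ}

@[simp] lemma braidOp_apply (p q : Fin n) (f : WordFun d n) (w) :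
    braidOp u p q f w
      = swapCoeff u (w p) (w q) * f (w ∘ Equiv.swap p q) + stayCoeff u (w p) (w q) * f w := rfl

@[simp] lemma diagOp_apply (c : (Fin n → ZMod d × Bool) → ℂ) (f : WordFun d n) (w) :
    diagOp c f w = c w * f w := rfl

lemma diagOp_mul (b c : (Fin n → ZMod d × Bool) → ℂ) :
    diagOp b * diagOp c = diagOp (b * c) := by
  ext f w; simp [mul_assoc]

lemma diagOp_one : diagOp (1 : (Fin n → ZMod d × Bool) → ℂ) = 1 := by
  ext f w; simp

lemma diagOp_pow (b : (Fin n → ZMod d × Bool) → ℂ) (m : ℕ) :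
    diagOp b ^ m = diagOp (b ^ m) := by
  induction m with
  | zero => rw [pow_zero, pow_zero, diagOp_one]
  | succ m ih => rw [pow_succ, pow_succ, ih, diagOp_mul]

lemma diagOp_smul (r : ℂ) (b : (Fin n → ZMod d × Bool) → ℂ) :
    r • diagOp b = diagOp (r • b) := by
  ext f w; simp [mul_assoc]

lemma diagOp_sum {ι : Type*} (s : Finset ι) (b : ι → (Fin n → ZMod d × Bool) → ℂ) :
    ∑ i ∈ s, diagOp (b i) = diagOp (∑ i ∈ s, b i) := by
  ext f w; simp [LinearMap.sum_apply, Finset.sum_mul]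

lemma braidOp_far {p q r s : Fin n} (hpr : p ≠ r) (hps : p ≠ s) (hqr : q ≠ r) (hqs : q ≠ s) :
    (braidOp u p q * braidOp u r s : Module.End ℂ (WordFun d n))
      = braidOp u r s * braidOp u p q := by
  refine LinearMap.ext fun f => funext fun w => ?_
  have hc : (w ∘ Equiv.swap p q) ∘ Equiv.swap r s = (w ∘ Equiv.swap r s) ∘ Equiv.swap p q := by
    funext i
    simp only [Function.comp_apply]
    congr 1
    have h : Equiv.Perm.Disjoint (Equiv.swap p q) (Equiv.swap r s) := by
      intro x
      by_cases hx : x = p ∨ x = q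
      · right
        rcases hx with rfl | rfl
        · exact Equiv.swap_apply_of_ne_of_ne hpr hps
        · exact Equiv.swap_apply_of_ne_of_ne hqr hqs
      · left
        push Not at hx
        exact Equiv.swap_apply_of_ne_of_ne hx.1 hx.2
    exact DFunLike.congr_fun h.commute.eq i
  simp only [Module.End.mul_apply, braidOp_apply, Function.comp_apply, hc,
    Equiv.swap_apply_of_ne_of_ne hpr.symm hqr.symm, Equiv.swap_apply_of_ne_of_ne hps.symm hqs.symm,
    Equiv.swap_apply_of_ne_of_ne hpr hps, Equiv.swap_apply_of_ne_of_ne hqr hqs]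
  ring

/-- This is the Yang–Baxter equation at a word with letters a, b, c. The F's stand for the values of
the function at the rearrangements of the word, the indices recording the swaps applied. Everything
depends only on which residues coincide and on the states, so a finite case check suffices. -/
lemma yangBaxter_coeff (a b c : ZMod d × Bool) (F F₁ F₂ F₁₂ F₂₁ F₁₂₁ : ℂ) :
    swapCoeff u a b * (swapCoeff u a c * (swapCoeff u b c * F₁₂₁ + stayCoeff u b c * F₁₂)
      + stayCoeff u a c * (swapCoeff u b a * F + stayCoeff u b a * F₁))
    + stayCoeff u a b * (swapCoeff u b c * (swapCoeff u a c * F₂₁ + stayCoeff u a c * F₂)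
      + stayCoeff u b c * (swapCoeff u a b * F₁ + stayCoeff u a b * F))
    = swapCoeff u b c * (swapCoeff u a c * (swapCoeff u a b * F₁₂₁ + stayCoeff u a b * F₂₁)
      + stayCoeff u a c * (swapCoeff u c b * F + stayCoeff u c b * F₂))
    + stayCoeff u b c * (swapCoeff u a b * (swapCoeff u a c * F₁₂ + stayCoeff u a c * F₁)
      + stayCoeff u a b * (swapCoeff u b c * F₂ + stayCoeff u b c * F)) := by
  obtain ⟨k, x⟩ := a
  obtain ⟨l, y⟩ := b
  obtain ⟨m, v⟩ := c
  by_cases hkl : k = l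
  · subst hkl
    by_cases hkm : k = m
    · subst hkm
      cases x <;> cases y <;> cases v <;> simp [swapCoeff, stayCoeff] <;> ring
    · cases x <;> cases y <;> cases v <;> simp [swapCoeff, stayCoeff, hkm, Ne.symm hkm]
  · by_cases hkm : k = m
    · subst hkm
      cases x <;> cases y <;> cases v <;>
        simp [swapCoeff, stayCoeff, hkl, Ne.symm hkl]
    · by_cases hlm : l = m
      · subst hlm
        cases x <;> cases y <;> cases v <;> simp [swapCoeff, stayCoeff, hkl, Ne.symm hkl]
      · simp [swapCoeff, stayCoeff, hkl, hkm, hlm, Ne.symm hkl, Ne.symm hlm]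

lemma braidOp_braid {p q r : Fin n} (hpq : p ≠ q) (hqr : q ≠ r) (hpr : p ≠ r) :
    (braidOp u p q * braidOp u q r * braidOp u p q : Module.End ℂ (WordFun d n))
      = braidOp u q r * braidOp u p q * braidOp u q r := by
  refine LinearMap.ext fun f => funext fun w => ?_
  have h11 : ∀ v : Fin n → ZMod d × Bool, (v ∘ Equiv.swap p q) ∘ Equiv.swap p q = v :=
    fun v => by funext i; simp
  have h22 : ∀ v : Fin n → ZMod d × Bool, (v ∘ Equiv.swap q r) ∘ Equiv.swap q r = v :=
    fun v => by funext i; simp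
  have hb : ((w ∘ Equiv.swap p q) ∘ Equiv.swap q r) ∘ Equiv.swap p q
      = ((w ∘ Equiv.swap q r) ∘ Equiv.swap p q) ∘ Equiv.swap q r := by
    have h : Equiv.swap p q * Equiv.swap q r * Equiv.swap p q
        = Equiv.swap q r * Equiv.swap p q * Equiv.swap q r := by
      -- Both products are the transposition of p and r.
      rw [Equiv.swap_mul_swap_mul_swap hpq hpr, Equiv.swap_comm p q, Equiv.swap_comm q r,
        Equiv.swap_mul_swap_mul_swap hqr.symm hpr.symm, Equiv.swap_comm]
    funext i
    exact congrArg w (DFunLike.congr_fun h i)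
  simp only [Module.End.mul_apply, braidOp_apply, Function.comp_apply, h11, h22, hb,
    Equiv.swap_apply_left, Equiv.swap_apply_right,
    Equiv.swap_apply_of_ne_of_ne hpr.symm hqr.symm, Equiv.swap_apply_of_ne_of_ne hpq hpr]
  exact yangBaxter_coeff (w p) (w q) (w r) _ _ _ _ _ _

lemma braidOp_sq {p q : Fin n} :
    (braidOp u p q ^ 2 : Module.End ℂ (WordFun d n))
      = 1 + (u - 1) • diagOp (fun w => if (w p).1 = (w q).1 then 1 else 0)
        + (u - 1) • (diagOp (fun w => if (w p).1 = (w q).1 then 1 else 0) * braidOp u p q) := by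
  refine LinearMap.ext fun f => funext fun w => ?_
  have h11 : (w ∘ Equiv.swap p q) ∘ Equiv.swap p q = w := by funext i; simp
  simp only [sq, Module.End.mul_apply, braidOp_apply, Function.comp_apply, h11,
    Equiv.swap_apply_left, Equiv.swap_apply_right, LinearMap.add_apply, LinearMap.smul_apply,
    diagOp_apply, Pi.add_apply, Pi.smul_apply, smul_eq_mul, Module.End.one_apply]
  generalize f (w ∘ Equiv.swap p q) = F₁
  generalize f w = F
  obtain ⟨k, x⟩ := w p
  obtain ⟨l, y⟩ := w q
  by_cases hkl : k = l
  · subst hkl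
    cases x <;> cases y <;> simp [swapCoeff, stayCoeff] <;> ring
  · simp [swapCoeff, stayCoeff, hkl, Ne.symm hkl]

/-- The swapped word contributes through `h1`. The unchanged word has a nonzero coefficient only
when the two residues agree, so b = c is needed only there. -/
lemma diagOp_mul_braidOp {p q : Fin n} (b c : (Fin n → ZMod d × Bool) → ℂ)
    (h1 : ∀ w, b w = c (w ∘ Equiv.swap p q)) (h2 : ∀ w, (w p).1 = (w q).1 → b w = c w) :
    diagOp b * braidOp u p q = braidOp u p q * diagOp c := by
  refine LinearMap.ext fun f => funext fun w => ?_
  simp only [Module.End.mul_apply, braidOp_apply, diagOp_apply, ← h1]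
  by_cases h : (w p).1 = (w q).1
  · rw [h2 w h]; ring
  · simp only [stayCoeff, h, if_false]; ring

/-- The character of the residue of a letter, as the scalar by which a framing generator acts. -/
def framingChar [NeZero d] (j : Fin n) (w : Fin n → ZMod d × Bool) : ℂ := ZMod.stdAddChar (w j).1

lemma stdAddChar_pow [NeZero d] (k : ZMod d) (m : ℕ) :
    (ZMod.stdAddChar k : ℂ) ^ m = ZMod.stdAddChar (k * (m : ZMod d)) := by
  rw [mul_comm, ← nsmul_eq_mul, AddChar.map_nsmul_eq_pow]

lemma sum_stdAddChar_mul [NeZero d] (k : ZMod d) :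
    ∑ s : ZMod d, ZMod.stdAddChar (k * s) = if k = 0 then (d : ℂ) else 0 := by
  split_ifs with h
  · simp [h, ZMod.card]
  · exact AddChar.sum_eq_zero_of_ne_one (ZMod.isPrimitive_stdAddChar d h)

lemma sum_range_natCast_zmod [NeZero d] (f : ZMod d → ℂ) :
    ∑ s ∈ Finset.range d, f (s : ZMod d) = ∑ s : ZMod d, f s :=
  Finset.sum_nbij' (fun s => (s : ZMod d)) ZMod.val (by simp) (by simp [ZMod.val_lt])
    (fun s hs => ZMod.val_cast_of_lt (Finset.mem_range.mp hs)) (by simp) (by simp)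

/-- Orthogonality of characters. Modulo d the exponent d - s is -s, so each term is the character of
the difference of the two residues, evaluated at s. -/
lemma framingAverage_diagOp [NeZero d] (p q : Fin n) :
    framingAverage d (diagOp (framingChar p)) (diagOp (framingChar q))
      = diagOp (fun w : Fin n → ZMod d × Bool => if (w p).1 = (w q).1 then 1 else 0) := by
  simp only [framingAverage, diagOp_pow, diagOp_mul, diagOp_sum, diagOp_smul]
  congr 1
  funext w
  have h : ∀ s ∈ Finset.range d,
      (framingChar p ^ s * framingChar q ^ (d - s) : (Fin n → ZMod d × Bool) → ℂ) w
        = ZMod.stdAddChar (((w p).1 - (w q).1) * (s : ZMod d)) := by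
    intro s hs
    rw [Pi.mul_apply, Pi.pow_apply, Pi.pow_apply, framingChar, framingChar, stdAddChar_pow,
      stdAddChar_pow, ← AddChar.map_add_eq_mul, Nat.cast_sub (Finset.mem_range.mp hs).le]
    congr 1
    simp
    ring
  rw [Pi.smul_apply, Finset.sum_apply, Finset.sum_congr rfl h,
    sum_range_natCast_zmod fun s => ZMod.stdAddChar (((w p).1 - (w q).1) * s), sum_stdAddChar_mul]
  by_cases h : (w p).1 = (w q).1
  · simp [h, NeZero.ne d]
  · simp [h, sub_eq_zero]

/-- The operators of the generators. -/
def wordOp [NeZero d] (u : ℂ) : Gen n → Module.End ℂ (WordFun d n)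
  | Gen.g i hi => braidOp u ⟨i, Nat.lt_of_succ_lt hi⟩ ⟨i + 1, hi⟩
  | Gen.t j => diagOp (framingChar j)

lemma wordOp_rel [NeZero d] ⦃a b : FreeAlgebra ℂ (Gen n)⦄ (h : YHRel d u n a b) :
    FreeAlgebra.lift ℂ (wordOp (d := d) u) a = FreeAlgebra.lift ℂ (wordOp u) b := by
  have he (i : ℕ) (hi : i + 1 < n) : FreeAlgebra.lift ℂ (wordOp (d := d) u) (fe d i hi)
      = diagOp (fun w => if (w ⟨i, Nat.lt_of_succ_lt hi⟩).1 = (w ⟨i + 1, hi⟩).1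
        then 1 else 0) := by
    rw [fe, map_framingAverage, FreeAlgebra.lift_ι_apply, FreeAlgebra.lift_ι_apply]
    exact framingAverage_diagOp _ _
  cases h with
  | far i j hi hj hij =>
      simp only [map_mul, FreeAlgebra.lift_ι_apply, wordOp]
      apply braidOp_far <;> simp only [ne_eq, Fin.mk.injEq] <;> omega
  | braid i hi hj =>
      simp only [map_mul, FreeAlgebra.lift_ι_apply, wordOp]
      apply braidOp_braid <;> simp only [ne_eq, Fin.mk.injEq] <;> omega
  | framing_comm i j =>
      simp only [map_mul, FreeAlgebra.lift_ι_apply, wordOp, diagOp_mul, mul_comm]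
  | framing_braid i hi j =>
      simp only [map_mul, FreeAlgebra.lift_ι_apply, wordOp]
      refine diagOp_mul_braidOp _ _ (fun w => ?_) fun w hw => ?_
      · simp [framingChar, strandSwap]
      · simp only [framingChar, strandSwap]
        congr 1
        rw [Equiv.swap_apply_def]
        split_ifs with h1 h2
        · rw [h1, hw]
        · rw [h2, hw]
        · rfl
  | framing_pow j =>
      simp only [map_pow, map_one, FreeAlgebra.lift_ι_apply, wordOp, diagOp_pow]
      rw [← diagOp_one]
      congr 1
      funext w
      simp [framingChar, stdAddChar_pow]
  | quadratic i hi =>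
      simp only [map_add, map_mul, map_pow, map_smul, map_one, he, FreeAlgebra.lift_ι_apply]
      exact braidOp_sq

/-- The representation of `Y_{d,n}(u)` on functions of coloured words. -/
def wordRep (d : ℕ) [NeZero d] (u : ℂ) (n : ℕ) : YH d u n →ₐ[ℂ] Module.End ℂ (WordFun d n) :=
  RingQuot.liftAlgHom ℂ ⟨FreeAlgebra.lift ℂ (wordOp u), wordOp_rel⟩

variable [NeZero d]

lemma wordRep_g (i : ℕ) (hi : i + 1 < n) :
    wordRep d u n (YH.g i hi) = braidOp u ⟨i, Nat.lt_of_succ_lt hi⟩ ⟨i + 1, hi⟩ := by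
  simp [wordRep, YH.g, YH.mk, wordOp]

lemma wordRep_t (j : Fin n) : wordRep d u n (YH.t j) = diagOp (framingChar j) := by
  simp [wordRep, YH.t, YH.mk, wordOp]

lemma wordRep_e (i : ℕ) (hi : i + 1 < n) :
    wordRep d u n (YH.e i hi)
      = diagOp (fun w => if (w ⟨i, Nat.lt_of_succ_lt hi⟩).1 = (w ⟨i + 1, hi⟩).1
        then 1 else 0) := by
  rw [YH.e, map_framingAverage, wordRep_t, wordRep_t, framingAverage_diagOp]

/-- Restriction to the words with last letter `c`. -/
def restrictLast (c : ZMod d × Bool) : WordFun d (n + 1) →ₗ[ℂ] WordFun d n where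
  toFun f w := f (Fin.snoc w c)
  map_add' _ _ := rfl
  map_smul' _ _ := rfl

/-- Operators from the smaller algebra leave the last letter alone. This makes the partial trace
over the last letter computable. -/
lemma restrictLast_wordRep_incl (c : ZMod d × Bool) (a : YH d u n) (f : WordFun d (n + 1)) :
    restrictLast c (wordRep d u (n + 1) (YH.incl d u n a) f)
      = wordRep d u n a (restrictLast c f) := by
  let S : Subalgebra ℂ (YH d u n) :=
    { carrier := {a | ∀ f, restrictLast c (wordRep d u (n + 1) (YH.incl d u n a) f)
        = wordRep d u n a (restrictLast c f)}
      mul_mem' := fun {a b} ha hb f => by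
        simp only [map_mul, Module.End.mul_apply]
        rw [ha, hb]
      add_mem' := fun {a b} ha hb f => by
        simp only [map_add, LinearMap.add_apply]
        rw [ha, hb]
      algebraMap_mem' := fun r f => by
        simp only [AlgHom.commutes, Module.algebraMap_end_apply, map_smul] }
  have hS : S = ⊤ := by
    refine YH.subalgebra_eq_top S (fun i hi f => ?_) fun j f => ?_
    · rw [YH.incl_g, wordRep_g, wordRep_g]
      funext w
      have h1 : (Fin.snoc w c : Fin (n + 1) → ZMod d × Bool) ∘ Equiv.swap
          (Fin.castSucc ⟨i, Nat.lt_of_succ_lt hi⟩) (Fin.castSucc ⟨i + 1, hi⟩)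
          = Fin.snoc (w ∘ Equiv.swap ⟨i, Nat.lt_of_succ_lt hi⟩ ⟨i + 1, hi⟩) c := by
        funext j
        induction j using Fin.lastCases with
        | last =>
            rw [Function.comp_apply, Equiv.swap_apply_of_ne_of_ne (Fin.castSucc_lt_last _).ne'
              (Fin.castSucc_lt_last _).ne', Fin.snoc_last, Fin.snoc_last]
        | cast j =>
            rw [Function.comp_apply, ← (Fin.castSucc_injective n).map_swap, Fin.snoc_castSucc,
              Fin.snoc_castSucc, Function.comp_apply]
      change braidOp u (Fin.castSucc ⟨i, Nat.lt_of_succ_lt hi⟩)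
        (Fin.castSucc ⟨i + 1, hi⟩) f (Fin.snoc w c) = _
      simp only [braidOp_apply, Fin.snoc_castSucc, h1]
      rfl
    · rw [YH.incl_t, wordRep_t, wordRep_t]
      funext w
      change diagOp _ f (Fin.snoc w c) = _
      simp only [diagOp_apply, framingChar, Fin.snoc_castSucc]
      rfl
  have ha : a ∈ S := hS ▸ Algebra.mem_top
  exact ha f

end model

/-! ### Weighted traces of the representation -/

section weightedTrace

variable {d : ℕ} {u z E : ℂ} {x : ZMod d → ℂ} {n : ℕ} {κ : ZMod d × Bool → ℂ}

/-- The product of the weights of the letters. -/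
def wordWeight (κ : ZMod d × Bool → ℂ) (w : Fin n → ZMod d × Bool) : ℂ := ∏ j, κ (w j)

lemma wordWeight_snoc (v : Fin n → ZMod d × Bool) (c : ZMod d × Bool) :
    wordWeight κ (Fin.snoc v c : Fin (n + 1) → ZMod d × Bool) = wordWeight κ v * κ c := by
  simp [wordWeight, Fin.prod_univ_castSucc]

/-- The Markov conditions carry a factor κ a because they can hold only on letters of nonzero
weight. Such a condition extends to a word through its last letter. -/
lemma wordWeight_mul_of_last {r t : ZMod d × Bool → ℂ} (h : ∀ a, κ a * r a = t a * κ a)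
    (v : Fin (n + 1) → ZMod d × Bool) :
    wordWeight κ v * r (v (Fin.last n)) = t (v (Fin.last n)) * wordWeight κ v := by
  rw [wordWeight, Fin.prod_univ_castSucc, mul_assoc, h]
  ring

lemma single_snoc_snoc (v v' : Fin n → ZMod d × Bool) (c c' : ZMod d × Bool) :
    (Pi.single (Fin.snoc v c : Fin (n + 1) → ZMod d × Bool) 1 : WordFun d (n + 1))
      (Fin.snoc v' c') = if v' = v ∧ c' = c then 1 else 0 := by
  simp only [Pi.single_apply, Fin.snoc_inj]

/-- The place before the last one. -/
abbrev prevPlace (n : ℕ) : Fin (n + 2) := ⟨n, Nat.lt_of_succ_lt (Nat.lt_succ_self (n + 1))⟩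

lemma swapCoeff_self (a : ZMod d × Bool) : swapCoeff u a a = 0 := by simp [swapCoeff]

lemma snoc_prevPlace (v : Fin (n + 1) → ZMod d × Bool) (c : ZMod d × Bool) :
    (Fin.snoc v c : Fin (n + 2) → ZMod d × Bool) (prevPlace n) = v (Fin.last n) :=
  Fin.snoc_castSucc (α := fun _ => ZMod d × Bool) c v (Fin.last n)

lemma snoc_lastPlace (v : Fin (n + 1) → ZMod d × Bool) (c : ZMod d × Bool) :
    (Fin.snoc v c : Fin (n + 2) → ZMod d × Bool) ⟨n + 1, Nat.lt_succ_self (n + 1)⟩ = c :=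
  Fin.snoc_last (α := fun _ => ZMod d × Bool) c v

lemma restrictLast_diagOp_single (b : (Fin (n + 1) → ZMod d × Bool) → ℂ)
    (v : Fin n → ZMod d × Bool) (c : ZMod d × Bool) :
    restrictLast c (diagOp b (Pi.single (Fin.snoc v c : Fin (n + 1) → ZMod d × Bool) 1))
      = b (Fin.snoc v c) • Pi.single v 1 := by
  funext v'
  change b (Fin.snoc v' c) * _ = b _ * _
  rw [single_snoc_snoc, Pi.single_apply]
  by_cases h : v' = v
  · simp [h]
  · simp [h]

/-- Only the unchanged word contributes to the partial trace. If the last two letters are equal the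
swap coefficient is zero; otherwise the swap changes the last letter. -/
lemma restrictLast_braidOp_single (v : Fin (n + 1) → ZMod d × Bool) (c : ZMod d × Bool) :
    restrictLast c (braidOp u (prevPlace n) ⟨n + 1, Nat.lt_succ_self (n + 1)⟩
      (Pi.single (Fin.snoc v c : Fin (n + 2) → ZMod d × Bool) 1))
      = stayCoeff u (v (Fin.last n)) c • Pi.single v 1 := by
  funext v'
  change braidOp _ _ _ _ (Fin.snoc v' c) = _
  have hswap : swapCoeff u (v' (Fin.last n)) c
      * (Pi.single (Fin.snoc v c : Fin (n + 2) → ZMod d × Bool) 1 : WordFun d (n + 2))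
        ((Fin.snoc v' c : Fin (n + 2) → ZMod d × Bool) ∘
          Equiv.swap (prevPlace n) ⟨n + 1, Nat.lt_succ_self (n + 1)⟩) = 0 := by
    by_cases hc : v' (Fin.last n) = c
    · rw [hc, swapCoeff_self, zero_mul]
    · rw [Pi.single_apply, if_neg, mul_zero]
      intro h
      have h' := congrFun h ⟨n + 1, Nat.lt_succ_self (n + 1)⟩
      rw [Function.comp_apply, Equiv.swap_apply_right, snoc_prevPlace, snoc_lastPlace] at h'
      exact hc h'
  rw [braidOp_apply, snoc_prevPlace, snoc_lastPlace, hswap, zero_add, single_snoc_snoc,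
    Pi.smul_apply, Pi.single_apply, smul_eq_mul]
  by_cases h : v' = v
  · simp [h]
  · simp [h]

variable [NeZero d]

lemma trace_wordFun (T : Module.End ℂ (WordFun d n)) :
    LinearMap.trace ℂ _ T = ∑ w, T (Pi.single w 1) w := by
  rw [LinearMap.trace_eq_matrix_trace ℂ (Pi.basisFun ℂ _), Matrix.trace]
  simp

/-- The weight of a word is a symmetric function of its letters; this is what makes the weighted
trace cyclic. -/
lemma wordWeight_commute (a : YH d u n) :
    Commute (diagOp (wordWeight κ)) (wordRep d u n a) := by
  let S : Subalgebra ℂ (YH d u n) :=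
    (Subalgebra.centralizer ℂ {diagOp (wordWeight κ)}).comap (wordRep d u n)
  have hS : S = ⊤ := by
    refine YH.subalgebra_eq_top S (fun i hi => ?_) fun j => ?_
    · change wordRep d u n _ ∈ Subalgebra.centralizer ℂ _
      rw [wordRep_g, Subalgebra.mem_centralizer_iff]
      rintro _ rfl
      refine diagOp_mul_braidOp _ _ (fun w => ?_) fun w _ => rfl
      exact (Equiv.prod_comp (Equiv.swap _ _) fun j => κ (w j)).symm
    · change wordRep d u n _ ∈ Subalgebra.centralizer ℂ _
      rw [wordRep_t, Subalgebra.mem_centralizer_iff]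
      rintro _ rfl
      rw [diagOp_mul, diagOp_mul, mul_comm]
  have ha : a ∈ S := hS ▸ Algebra.mem_top
  exact (Subalgebra.mem_centralizer_iff ℂ).mp ha _ rfl

/-- The trace of the representation, weighted by the letters. -/
def wordTrace (u : ℂ) (κ : ZMod d × Bool → ℂ) (n : ℕ) : YH d u n →ₗ[ℂ] ℂ :=
  LinearMap.trace ℂ _ ∘ₗ LinearMap.mulLeft ℂ (diagOp (wordWeight κ)) ∘ₗ
    (wordRep d u n).toLinearMap

lemma wordTrace_apply (a : YH d u n) :
    wordTrace u κ n a = ∑ w, wordWeight κ w * wordRep d u n a (Pi.single w 1) w := by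
  simp only [wordTrace, LinearMap.comp_apply, LinearMap.mulLeft_apply, trace_wordFun]
  rfl

lemma wordTrace_mul_comm (a b : YH d u n) :
    wordTrace u κ n (a * b) = wordTrace u κ n (b * a) := by
  simp only [wordTrace, LinearMap.comp_apply, LinearMap.mulLeft_apply, AlgHom.toLinearMap_apply,
    map_mul]
  rw [← mul_assoc, (wordWeight_commute a).eq, mul_assoc, LinearMap.trace_mul_comm, mul_assoc]

/-- The partial trace over the last letter. -/
lemma wordTrace_incl_mul (b : YH d u (n + 1)) (s : (Fin n → ZMod d × Bool) → ZMod d × Bool → ℂ)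
    (Z : ℂ)
    (hs : ∀ v c, restrictLast c (wordRep d u (n + 1) b
      (Pi.single (Fin.snoc v c : Fin (n + 1) → ZMod d × Bool) 1)) = s v c • Pi.single v 1)
    (hZ : ∀ v, wordWeight κ v * ∑ c, κ c * s v c = Z * wordWeight κ v) (a : YH d u n) :
    wordTrace u κ (n + 1) (YH.incl d u n a * b) = Z * wordTrace u κ n a := by
  have key : ∀ v c, wordRep d u (n + 1) (YH.incl d u n a * b)
      (Pi.single (Fin.snoc v c : Fin (n + 1) → ZMod d × Bool) 1) (Fin.snoc v c)
      = s v c * wordRep d u n a (Pi.single v 1) v := by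
    intro v c
    rw [map_mul, Module.End.mul_apply]
    change restrictLast c (wordRep d u (n + 1) (YH.incl d u n a) _) v = _
    rw [restrictLast_wordRep_incl, hs, map_smul]
    rfl
  -- The sum over words is split into a word v and a last letter c; `hZ` then evaluates the inner
  -- sum over c.
  rw [wordTrace_apply, wordTrace_apply,
    ← Equiv.sum_comp (Fin.snocEquiv fun _ : Fin (n + 1) => ZMod d × Bool), Fintype.sum_prod_type,
    Finset.sum_comm, Finset.mul_sum]
  refine Finset.sum_congr rfl fun v _ => ?_
  rw [← mul_assoc, ← hZ v, Finset.mul_sum, Finset.sum_mul]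
  refine Finset.sum_congr rfl fun c _ => ?_
  have h := key v c
  change wordWeight κ (Fin.snoc v c : Fin (n + 1) → ZMod d × Bool) * (wordRep d u (n + 1) _)
    (Pi.single (Fin.snoc v c : Fin (n + 1) → ZMod d × Bool) 1) (Fin.snoc v c) = _
  rw [h, wordWeight_snoc]
  ring

/-- The conditions on the weights under which the weighted trace is a Juyumaya trace. -/
structure IsMarkovWeight (u z E : ℂ) (x : ZMod d → ℂ) (κ : ZMod d × Bool → ℂ) : Prop where
  framing : ∀ m : ZMod d, ∑ c, κ c * ZMod.stdAddChar (c.1 * m) = x m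
  zero : x 0 = 1
  stay : ∀ a, κ a * ∑ c, κ c * stayCoeff u a c = z * κ a
  residue : ∀ a, κ a * ∑ c, κ c * (if a.1 = c.1 then 1 else 0) = E * κ a

lemma IsMarkovWeight.total (h : IsMarkovWeight u z E x κ) : ∑ c, κ c = 1 := by
  simpa [h.zero] using h.framing 0

lemma IsMarkovWeight.trace_incl (h : IsMarkovWeight u z E x κ) (a : YH d u n) :
    wordTrace u κ (n + 1) (YH.incl d u n a) = wordTrace u κ n a := by
  have := wordTrace_incl_mul (κ := κ) (1 : YH d u (n + 1)) (fun _ _ => 1) 1 (fun v c => ?_)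
    (fun v => ?_) a
  · simpa using this
  · rw [map_one, ← diagOp_one, restrictLast_diagOp_single]
    rfl
  · simp [h.total]

lemma IsMarkovWeight.trace_framing (h : IsMarkovWeight u z E x κ) (a : YH d u n) (m : ℕ) :
    wordTrace u κ (n + 1) (YH.incl d u n a * YH.t (Fin.last n) ^ m)
      = x (m : ZMod d) * wordTrace u κ n a := by
  refine wordTrace_incl_mul _ (fun _ c => ZMod.stdAddChar (c.1 * (m : ZMod d))) _ (fun v c => ?_)
    (fun v => ?_) a
  · rw [map_pow, wordRep_t, diagOp_pow, restrictLast_diagOp_single, Pi.pow_apply, framingChar,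
      stdAddChar_pow, Fin.snoc_last]
  · rw [h.framing, mul_comm]

lemma IsMarkovWeight.trace_g (h : IsMarkovWeight u z E x κ) (a : YH d u (n + 1)) :
    wordTrace u κ (n + 2) (YH.incl d u (n + 1) a * YH.g n (Nat.lt_succ_self _))
      = z * wordTrace u κ (n + 1) a := by
  refine wordTrace_incl_mul _ (fun v c => stayCoeff u (v (Fin.last n)) c) _ (fun v c => ?_)
    (fun v => ?_) a
  · rw [wordRep_g, restrictLast_braidOp_single]
  · exact wordWeight_mul_of_last (r := fun a => ∑ c, κ c * stayCoeff u a c) (t := fun _ => z)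
      h.stay v

lemma IsMarkovWeight.trace_e (h : IsMarkovWeight u z E x κ) (a : YH d u (n + 1)) :
    wordTrace u κ (n + 2) (YH.incl d u (n + 1) a * YH.e n (Nat.lt_succ_self _))
      = E * wordTrace u κ (n + 1) a := by
  refine wordTrace_incl_mul _ (fun v c => if (v (Fin.last n)).1 = c.1 then 1 else 0) _
    (fun v c => ?_) (fun v => ?_) a
  · rw [wordRep_e, restrictLast_diagOp_single, snoc_prevPlace, snoc_lastPlace]
  · exact wordWeight_mul_of_last
      (r := fun a => ∑ c, κ c * (if a.1 = c.1 then 1 else 0)) (t := fun _ => E) h.residue v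

/-- The diagonal coefficient of g already vanishes on different residues, so the projection e does
not change the partial trace. -/
lemma IsMarkovWeight.trace_e_mul_g (h : IsMarkovWeight u z E x κ) (a : YH d u (n + 1)) :
    wordTrace u κ (n + 2) (YH.incl d u (n + 1) a
      * (YH.e n (Nat.lt_succ_self _) * YH.g n (Nat.lt_succ_self _)))
      = z * wordTrace u κ (n + 1) a := by
  refine wordTrace_incl_mul _ (fun v c => stayCoeff u (v (Fin.last n)) c) _ (fun v c => ?_)
    (fun v => ?_) a
  · rw [map_mul, wordRep_g, wordRep_e, Module.End.mul_apply]
    have hb := restrictLast_braidOp_single (u := u) v c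
    funext v'
    have hb' := congrFun hb v'
    change _ * braidOp _ _ _ _ (Fin.snoc v' c) = _
    change braidOp _ _ _ _ (Fin.snoc v' c) = _ at hb'
    rw [hb']
    beta_reduce
    rw [snoc_prevPlace, snoc_lastPlace, Pi.smul_apply, Pi.single_apply, smul_eq_mul]
    by_cases hv : v' = v
    · subst hv
      by_cases hc : (v' (Fin.last n)).1 = c.1
      · simp [hc]
      · simp [hc, stayCoeff]
    · simp [hv]
  · exact wordWeight_mul_of_last (r := fun a => ∑ c, κ c * stayCoeff u a c) (t := fun _ => z)
      h.stay v

lemma IsMarkovWeight.trace_one (h : IsMarkovWeight u z E x κ) (n : ℕ) :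
    wordTrace u κ n 1 = 1 := by
  induction n with
  | zero =>
      rw [wordTrace_apply, map_one]
      simp [wordWeight]
  | succ n ih => rw [← map_one (YH.incl d u n), h.trace_incl, ih]

theorem IsMarkovWeight.isJuyumayaTrace (h : IsMarkovWeight u z E x κ) :
    IsJuyumayaTrace d u z x (wordTrace u κ) where
  compatible _ := h.trace_incl
  one := h.trace_one
  mul_comm _ := wordTrace_mul_comm
  braiding _ := h.trace_g
  framing _ a m _ _ := h.trace_framing a m

/-- The weights `p`, `q` on the two letters of each residue in `D`, divided by `|D|`. -/
def subsetWeight (D : Finset (ZMod d)) (p q : ℂ) (c : ZMod d × Bool) : ℂ :=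
  if c.1 ∈ D then (D.card : ℂ)⁻¹ * (if c.2 then q else p) else 0

/-- Letters of different residues do not interact in the partial trace, so all conditions reduce to
a single residue. There `hpq` is the normalization, and `hp`, `hq` are the rule for g at the two
states, with the factors 1/|D| cleared. Each residue in D has total weight 1/|D|, which is the value
of E. -/
lemma isMarkovWeight_subsetWeight {D : Finset (ZMod d)} (hD : D.Nonempty) {p q : ℂ}
    (hpq : p + q = 1) (hp : -(p * p) = z * D.card * p)
    (hq : q * ((u - 1) * p - q) = z * D.card * q) :
    IsMarkovWeight u z (D.card : ℂ)⁻¹ (eSolution D) (subsetWeight D p q) := by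
  have hc : (D.card : ℂ) ≠ 0 := Nat.cast_ne_zero.mpr hD.card_pos.ne'
  refine ⟨fun m => ?_, ?_, ?_, ?_⟩
  · rw [Fintype.sum_prod_type, eSolution, Finset.mul_sum, ← Finset.sum_filter_add_sum_filter_not
      Finset.univ (fun k => k ∈ D), Finset.sum_eq_zero (s := Finset.univ.filter fun k => k ∉ D),
      add_zero, Finset.filter_univ_mem]
    · refine Finset.sum_congr rfl fun k hk => ?_
      simp only [subsetWeight, hk, Fintype.sum_bool]
      simp only [if_true, Bool.false_eq_true, if_false]
      linear_combination (D.card : ℂ)⁻¹ * ZMod.stdAddChar (k * m) * hpq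
    · intro k hk
      simp [subsetWeight, (Finset.mem_filter.mp hk).2]
  · simp [eSolution, hc]
  · rintro ⟨k, b⟩
    by_cases hk : k ∈ D
    · rw [Fintype.sum_prod_type, Finset.sum_eq_single k]
      · cases b
        · simp only [subsetWeight, hk, stayCoeff, Fintype.sum_bool, if_true, Bool.false_eq_true,
            if_false]
          field_simp
          simp
          linear_combination hp
        · simp only [subsetWeight, hk, stayCoeff, Fintype.sum_bool, if_true, Bool.false_eq_true,
            if_false]
          field_simp
          simp
          linear_combination hq
      · intro l _ hl
        simp [stayCoeff, hl.symm]
      · simp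
    · simp [subsetWeight, hk]
  · rintro ⟨k, b⟩
    by_cases hk : k ∈ D
    · rw [Fintype.sum_prod_type, Finset.sum_eq_single k]
      · simp only [subsetWeight, hk, Fintype.sum_bool, if_true, Bool.false_eq_true, if_false]
        linear_combination (D.card : ℂ)⁻¹ * (D.card : ℂ)⁻¹ * (if b = true then q else p) * hpq
      · intro l _ hl
        simp [hl.symm]
      · simp
    · simp [subsetWeight, hk]

end weightedTrace

/-! ### The representation factors through the framization of the Temperley--Lieb algebra -/

section passing

variable {d : ℕ} {u : ℂ} {n : ℕ}

/-- On three letters of the same residue, the sum of the images of the six permutations is zero: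
this is where it matters that there are only two letters for each residue. -/
lemma steinberg_coeff (k : ZMod d) (x y v : Bool) (F F₁ F₂ F₁₂ F₂₁ F₁₂₁ : ℂ) :
    let a : ZMod d × Bool := (k, x)
    let b : ZMod d × Bool := (k, y)
    let c : ZMod d × Bool := (k, v)
    swapCoeff u a b * (swapCoeff u a c * (swapCoeff u b c * F₁₂₁ + stayCoeff u b c * F₁₂)
      + stayCoeff u a c * (swapCoeff u b a * F + stayCoeff u b a * F₁))
    + stayCoeff u a b * (swapCoeff u b c * (swapCoeff u a c * F₂₁ + stayCoeff u a c * F₂)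
      + stayCoeff u b c * (swapCoeff u a b * F₁ + stayCoeff u a b * F))
    + (swapCoeff u b c * (swapCoeff u a c * F₂₁ + stayCoeff u a c * F₂)
      + stayCoeff u b c * (swapCoeff u a b * F₁ + stayCoeff u a b * F))
    + (swapCoeff u a b * (swapCoeff u a c * F₁₂ + stayCoeff u a c * F₁)
      + stayCoeff u a b * (swapCoeff u b c * F₂ + stayCoeff u b c * F))
    + (swapCoeff u a b * F₁ + stayCoeff u a b * F)
    + (swapCoeff u b c * F₂ + stayCoeff u b c * F) + F = 0 := by
  cases x <;> cases y <;> cases v <;> simp [swapCoeff, stayCoeff] <;> ring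

variable [NeZero d]

lemma wordRep_steinberg_apply (i : ℕ) (hi : i + 2 < n) (f : WordFun d n)
    (w : Fin n → ZMod d × Bool)
    (h1 : (w ⟨i, Nat.lt_of_succ_lt (Nat.lt_of_succ_lt hi)⟩).1 = (w ⟨i + 2, hi⟩).1)
    (h2 : (w ⟨i + 1, Nat.lt_of_succ_lt hi⟩).1 = (w ⟨i + 2, hi⟩).1) :
    wordRep d u n (YH.steinberg i hi) f w = 0 := by
  simp only [YH.steinberg, map_add, map_mul, map_one, wordRep_g]
  set p : Fin n := ⟨i, Nat.lt_of_succ_lt (Nat.lt_of_succ_lt hi)⟩ with hp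
  set q : Fin n := ⟨i + 1, Nat.lt_of_succ_lt hi⟩ with hq
  change (braidOp u p q * braidOp u q ⟨i + 2, hi⟩ * braidOp u p q
    + braidOp u q ⟨i + 2, hi⟩ * braidOp u p q + braidOp u p q * braidOp u q ⟨i + 2, hi⟩
    + braidOp u p q + braidOp u q ⟨i + 2, hi⟩ + 1 : Module.End ℂ _) f w = 0
  set r : Fin n := ⟨i + 2, hi⟩ with hr
  have hpq : p ≠ q := by simp [hp, hq]
  have hpr : p ≠ r := by simp [hp, hr]
  have hqr : q ≠ r := by simp [hq, hr]
  have h11 : ∀ v : Fin n → ZMod d × Bool, (v ∘ Equiv.swap p q) ∘ Equiv.swap p q = v :=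
    fun v => by funext i; simp
  simp only [LinearMap.add_apply, Pi.add_apply, Module.End.one_apply, Module.End.mul_apply,
    braidOp_apply, Function.comp_apply, h11, Equiv.swap_apply_left, Equiv.swap_apply_right,
    Equiv.swap_apply_of_ne_of_ne hpr.symm hqr.symm, Equiv.swap_apply_of_ne_of_ne hpq hpr]
  have h := steinberg_coeff (u := u) (w r).1 (w p).2 (w q).2 (w r).2 (f w)
    (f (w ∘ Equiv.swap p q)) (f (w ∘ Equiv.swap q r)) (f ((w ∘ Equiv.swap p q) ∘ Equiv.swap q r))
    (f ((w ∘ Equiv.swap q r) ∘ Equiv.swap p q))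
    (f (((w ∘ Equiv.swap p q) ∘ Equiv.swap q r) ∘ Equiv.swap p q))
  have ea : ((w r).1, (w p).2) = w p := by rw [← h1]
  have eb : ((w r).1, (w q).2) = w q := by rw [← h2]
  have ec : ((w r).1, (w r).2) = w r := rfl
  rw [ea, eb, ec] at h
  linear_combination h

/-- With γ = -α - β eliminated, the framing factor is a product of two character sums in the
differences of residues. It vanishes unless the three residues agree, and in that case the other
factor vanishes. -/
lemma wordRep_r (i : ℕ) (hi : i + 2 < n) : wordRep d u n (YH.r i hi) = 0 := by
  refine LinearMap.ext fun f => funext fun w => ?_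
  rw [YH.r, map_mul, Module.End.mul_apply]
  simp only [map_sum, map_mul, map_pow, wordRep_t, diagOp_pow, diagOp_mul, diagOp_sum,
    diagOp_apply, Finset.sum_apply, Pi.mul_apply, Pi.pow_apply, framingChar, stdAddChar_pow,
    ZMod.natCast_zmod_val, LinearMap.zero_apply, Pi.zero_apply]
  set a := (w ⟨i, Nat.lt_of_succ_lt (Nat.lt_of_succ_lt hi)⟩).1 with ha
  set b := (w ⟨i + 1, Nat.lt_of_succ_lt hi⟩).1 with hb
  set c := (w ⟨i + 2, hi⟩).1 with hc
  by_cases h : a = c ∧ b = c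
  · rw [wordRep_steinberg_apply i hi f w h.1 h.2, mul_zero]
  · have hs : ∀ α β : ZMod d, (ZMod.stdAddChar (a * α) * ZMod.stdAddChar (b * β)
        * ZMod.stdAddChar (c * (-α - β)) : ℂ)
        = ZMod.stdAddChar ((a - c) * α) * ZMod.stdAddChar ((b - c) * β) := by
      intro α β
      rw [← AddChar.map_add_eq_mul, ← AddChar.map_add_eq_mul, ← AddChar.map_add_eq_mul]
      congr 1
      ring
    simp only [hs, ← Finset.mul_sum, ← Finset.sum_mul, sum_stdAddChar_mul, sub_eq_zero]
    rcases not_and_or.mp h with h | h <;> simp [h]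

lemma wordRep_eq_zero {a : YH d u n} (ha : a ∈ ftlIdeal d u n) : wordRep d u n a = 0 := by
  have h : a ∈ TwoSidedIdeal.ker (wordRep d u n) := by
    refine TwoSidedIdeal.mem_span_iff.mp ha _ ?_
    rintro _ ⟨i, hi, rfl⟩
    exact (TwoSidedIdeal.mem_ker _).mpr (wordRep_r i hi)
  exact (TwoSidedIdeal.mem_ker _).mp h

lemma FTL.mk_eq_mk_iff {a b : YH d u n} :
    FTL.mk d u n a = FTL.mk d u n b ↔ a - b ∈ ftlIdeal d u n := by
  rw [← TwoSidedIdeal.rel_iff]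
  exact (ftlIdeal d u n).ringCon.eq

/-- The trace passes to the quotient if and only if it vanishes on the ideal. -/
lemma tracePasses_iff {z : ℂ} {x : ZMod d → ℂ} :
    TracePasses d u n z x ↔ ∃ tr : ∀ n, YH d u n →ₗ[ℂ] ℂ, IsJuyumayaTrace d u z x tr ∧
      ∀ a ∈ ftlIdeal d u n, tr n a = 0 := by
  refine ⟨?_, ?_⟩
  · rintro ⟨tr, htr, φ, hφ⟩
    refine ⟨tr, htr, fun a ha => ?_⟩
    rw [← hφ, FTL.mk_eq_mk_iff.mpr ((sub_zero a).symm ▸ ha : a - 0 ∈ _), map_zero, map_zero]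
  · rintro ⟨tr, htr, h0⟩
    refine ⟨tr, htr, ⟨⟨Quotient.lift (tr n) fun a b hab => ?_, ?_⟩, ?_⟩, fun a => rfl⟩
    · have h := h0 _ ((ftlIdeal d u n).rel_iff a b |>.mp hab)
      rwa [map_sub, sub_eq_zero] at h
    · rintro ⟨a⟩ ⟨b⟩
      exact map_add (tr n) a b
    · rintro r ⟨a⟩
      exact map_smul (tr n) r a

theorem IsMarkovWeight.tracePasses {z E : ℂ} {x : ZMod d → ℂ} {κ : ZMod d × Bool → ℂ}
    (h : IsMarkovWeight u z E x κ) (n : ℕ) : TracePasses d u n z x := by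
  refine tracePasses_iff.mpr ⟨wordTrace u κ, h.isJuyumayaTrace, fun a ha => ?_⟩
  rw [wordTrace_apply, wordRep_eq_zero ha]
  simp

end passing

/-! ### The E-system -/

section ESystem

variable {d : ℕ} [NeZero d] {x : ZMod d → ℂ}

lemma eSolution_eq_invDFT (D : Finset (ZMod d)) :
    eSolution D = ZMod.dft.symm (fun k => if k ∈ D then (d : ℂ) * (D.card : ℂ)⁻¹ else 0) := by
  funext m
  have hd : (d : ℂ) ≠ 0 := NeZero.ne _
  simp only [eSolution, ZMod.invDFT_apply, smul_eq_mul, mul_ite, mul_zero]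
  rw [Finset.sum_ite_mem, Finset.univ_inter, Finset.mul_sum, Finset.mul_sum]
  refine Finset.sum_congr rfl fun k _ => ?_
  field_simp

lemma dft_eSolution (D : Finset (ZMod d)) (k : ZMod d) :
    ZMod.dft (eSolution D) k = if k ∈ D then (d : ℂ) * (D.card : ℂ)⁻¹ else 0 := by
  rw [eSolution_eq_invDFT, LinearEquiv.apply_symm_apply]

lemma eSolution_zero {D : Finset (ZMod d)} (hD : D.Nonempty) : eSolution D 0 = 1 := by
  have hc : (D.card : ℂ) ≠ 0 := Nat.cast_ne_zero.mpr hD.card_pos.ne'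
  simp [eSolution, hc]

/-- A function whose Fourier transform is constant on its support. -/
lemma eq_eSolution_of_dft (h0 : x 0 = 1) {D : Finset (ZMod d)} {C : ℂ}
    (hx : ∀ k, ZMod.dft x k = if k ∈ D then C else 0) :
    D.Nonempty ∧ C * D.card = d ∧ x = eSolution D := by
  have hd : (d : ℂ) ≠ 0 := NeZero.ne _
  have hx' : x = ZMod.dft.symm (fun k => if k ∈ D then C else 0) := by
    rw [LinearEquiv.eq_symm_apply]; exact funext hx
  have hC : C * D.card = d := by
    -- Fourier inversion at 0 reads x_0 = C|D|/d, so x_0 = 1 fixes C and excludes an empty support.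
    have h := congrFun hx' 0
    rw [h0, ZMod.invDFT_apply] at h
    simp only [mul_zero, AddChar.map_zero_eq_one, one_mul, Finset.sum_ite_mem,
      Finset.univ_inter, Finset.sum_const, nsmul_eq_mul, smul_eq_mul] at h
    field_simp at h
    rw [mul_comm, ← h]
  have hc : (D.card : ℂ) ≠ 0 := fun h => hd (by rw [← hC, h, mul_zero])
  refine ⟨?_, hC, ?_⟩
  · rw [Finset.nonempty_iff_ne_empty]
    rintro rfl
    simp at hc
  · rw [hx', eSolution_eq_invDFT, ← hC]
    congr 1
    funext k
    split_ifs
    · field_simp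
    · rfl

lemma dft_convolution (x : ZMod d → ℂ) (k : ZMod d) :
    ZMod.dft (fun m => ∑ s, x (m + s) * x (-s)) k = ZMod.dft x k ^ 2 := by
  simp only [ZMod.dft_apply, smul_eq_mul, sq, Finset.mul_sum, Finset.sum_mul]
  -- The substitutions s ↦ -s and m ↦ m + s separate the double sum into a product.
  rw [Finset.sum_comm, ← Equiv.sum_comp (Equiv.neg (ZMod d))]
  refine Finset.sum_congr rfl fun s _ => ?_
  rw [← Equiv.sum_comp (Equiv.addRight s)]
  refine Finset.sum_congr rfl fun m _ => ?_
  have h : -((m + s) * k) = -(m * k) + -(s * k) := by ring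
  simp only [Equiv.neg_apply, Equiv.coe_addRight, h, AddChar.map_add_eq_mul, neg_neg,
    add_neg_cancel_right]
  ring

/-- The E-system says that x convolved with itself is a multiple of x. The equation at m = 0 is
automatic once x_0 = 1, with the constant C equal to the convolution at 0. -/
lemma isESolution_iff_dft (h0 : x 0 = 1) :
    IsESolution x ↔ ∃ C, ∀ k, ZMod.dft x k ^ 2 = C * ZMod.dft x k := by
  have hd : (d : ℂ) ≠ 0 := NeZero.ne _
  have key : ∀ C : ℂ, (∀ m, ∑ s, x (m + s) * x (-s) = C * x m)
      ↔ ∀ k, ZMod.dft x k ^ 2 = C * ZMod.dft x k := by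
    intro C
    have h1 : (fun m => C * x m) = C • x := rfl
    rw [← funext_iff (f := fun m => ∑ s, x (m + s) * x (-s)) (g := fun m => C * x m),
      ← ZMod.dft.injective.eq_iff, h1, map_smul, funext_iff]
    simp only [dft_convolution, Pi.smul_apply, smul_eq_mul]
  simp only [← key]
  constructor
  · rintro ⟨-, h⟩
    refine ⟨∑ s, x (0 + s) * x (-s), fun m => ?_⟩
    rcases eq_or_ne m 0 with rfl | hm
    · rw [h0, mul_one]
    · have := h m hm
      simp only [EVal] at this
      rw [mul_left_comm] at this
      rw [mul_left_cancel₀ (inv_ne_zero hd) this, mul_comm]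
  · rintro ⟨C, h⟩
    refine ⟨h0, fun m _ => ?_⟩
    rw [EVal, EVal, h, h, h0]
    ring

lemma isESolution_eSolution {D : Finset (ZMod d)} (hD : D.Nonempty) :
    IsESolution (eSolution D) := by
  refine (isESolution_iff_dft (eSolution_zero hD)).mpr ⟨d * (D.card : ℂ)⁻¹, fun k => ?_⟩
  rw [dft_eSolution]
  split_ifs <;> ring

lemma eSolution_injOn {D D' : Finset (ZMod d)} (hD : D.Nonempty) (hD' : D'.Nonempty)
    (h : eSolution D = eSolution D') : D = D' := by
  have hd : (d : ℂ) ≠ 0 := NeZero.ne _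
  have hc : (D.card : ℂ) ≠ 0 := Nat.cast_ne_zero.mpr hD.card_pos.ne'
  have hc' : (D'.card : ℂ) ≠ 0 := Nat.cast_ne_zero.mpr hD'.card_pos.ne'
  ext k
  have hk := dft_eSolution D k
  rw [h, dft_eSolution] at hk
  by_cases h1 : k ∈ D <;> by_cases h2 : k ∈ D' <;> simp_all

open Classical in
lemma existsUnique_eSolution (h : IsESolution x) :
    ∃! D : Finset (ZMod d), D.Nonempty ∧ x = eSolution D := by
  obtain ⟨C, hC⟩ := (isESolution_iff_dft h.1).mp h
  -- The required set of residues is the support of the Fourier transform.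
  have hx : ∀ k, ZMod.dft x k = if k ∈ ({k | ZMod.dft x k ≠ 0} : Finset (ZMod d)) then C else 0 := by
    intro k
    by_cases hk : ZMod.dft x k = 0
    · simp [hk]
    · simp only [Finset.mem_filter, Finset.mem_univ, true_and, ne_eq, hk, not_false_eq_true, if_true]
      exact mul_right_cancel₀ hk (by rw [← sq, hC k])
  obtain ⟨hne, -, he⟩ := eq_eSolution_of_dft h.1 hx
  refine ⟨_, ⟨hne, he⟩, fun D' hD' => ?_⟩
  exact eSolution_injOn hD'.1 hne (hD'.2.symm.trans he)

end ESystem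

/-! ### Values of the trace on three strands, and the necessary condition -/

section necessary

variable {d : ℕ} {u z : ℂ} {x : ZMod d → ℂ} {tr : ∀ n, YH d u n →ₗ[ℂ] ℂ} {n : ℕ}

/-- The power of a framing generator with exponent a residue. -/
def YH.tz (j : Fin n) (a : ZMod d) : YH d u n := YH.t j ^ a.val

lemma YH.tz_natCast (j : Fin n) (m : ℕ) : (YH.tz j (m : ZMod d) : YH d u n) = YH.t j ^ m := by
  rw [YH.tz, ZMod.val_natCast, YH.t_pow_mod]

lemma YH.tz_commute (i j : Fin n) (a b : ZMod d) :
    Commute (YH.tz i a : YH d u n) (YH.tz j b) :=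
  (show Commute (YH.t i : YH d u n) (YH.t j) from YH.framing_comm i j).pow_pow _ _

lemma YH.incl_tz (j : Fin n) (a : ZMod d) :
    YH.incl d u n (YH.tz j a) = YH.tz j.castSucc a := by
  rw [YH.tz, map_pow, YH.incl_t, YH.tz]

lemma YH.tz_last_commute_incl (a : ZMod d) (b : YH d u n) :
    Commute (YH.tz (Fin.last n) a : YH d u (n + 1)) (YH.incl d u n b) :=
  (YH.t_last_commute_incl b).pow_left _

lemma YH.tz_left_mul_g (i : ℕ) (hi : i + 1 < n) (a : ZMod d) :
    (YH.tz ⟨i, Nat.lt_of_succ_lt hi⟩ a * YH.g i hi : YH d u n)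
      = YH.g i hi * YH.tz ⟨i + 1, hi⟩ a :=
  YH.t_left_pow_mul_g i hi _

lemma YH.tz_right_mul_g (i : ℕ) (hi : i + 1 < n) (a : ZMod d) :
    (YH.tz ⟨i + 1, hi⟩ a * YH.g i hi : YH d u n)
      = YH.g i hi * YH.tz ⟨i, Nat.lt_of_succ_lt hi⟩ a :=
  YH.t_right_pow_mul_g i hi _

lemma YH.incl_steinberg (i : ℕ) (hi : i + 2 < n) :
    YH.incl d u n (YH.steinberg i hi) = YH.steinberg i (Nat.lt_succ_of_lt hi) := by
  simp only [YH.steinberg, map_add, map_mul, map_one, YH.incl_g]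

/-- The last braiding generator between elements on fewer strands. -/
lemma IsJuyumayaTrace.tr_incl_tz_g_incl (h : IsJuyumayaTrace d u z x tr) (a b : YH d u (n + 1)) (c : ZMod d) :
    tr (n + 2) (YH.incl d u (n + 1) a * YH.tz (Fin.last (n + 1)) c
        * YH.g n (Nat.lt_succ_self _) * YH.incl d u (n + 1) b)
      = z * tr (n + 1) (YH.tz (Fin.last n) c * b * a) := by
  -- Passing g moves the last framing power to the previous strand, inside the smaller algebra.
  -- Cyclicity then brings g to the right end, where the Markov rule applies.
  have h1 := YH.tz_right_mul_g (d := d) (u := u) n (Nat.lt_succ_self (n + 1)) c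
  change YH.tz (Fin.last (n + 1)) c * _ = _ * YH.tz (Fin.castSucc (Fin.last n)) c at h1
  rw [← YH.incl_tz] at h1
  rw [← h.braiding, map_mul (YH.incl d u _), map_mul (YH.incl d u _), mul_assoc (YH.incl d u (n + 1) a), h1,
    h.mul_comm, ← mul_assoc, ← mul_assoc, h.mul_comm]
  simp only [mul_assoc]

variable [NeZero d]

lemma YH.tz_add (j : Fin n) (a b : ZMod d) :
    (YH.tz j (a + b) : YH d u n) = YH.tz j a * YH.tz j b := by
  rw [YH.tz, ZMod.val_add, YH.t_pow_mod, pow_add, YH.tz, YH.tz]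

lemma YH.e_eq_sum_tz (i : ℕ) (hi : i + 1 < n) :
    (YH.e i hi : YH d u n)
      = (d : ℂ)⁻¹ • ∑ s : ZMod d, YH.tz ⟨i, Nat.lt_of_succ_lt hi⟩ s * YH.tz ⟨i + 1, hi⟩ (-s) := by
  rw [YH.e, framingAverage]
  congr 1
  have h : ∀ s ∈ Finset.range d, (YH.t ⟨i, Nat.lt_of_succ_lt hi⟩ ^ s
      * YH.t ⟨i + 1, hi⟩ ^ (d - s) : YH d u n)
      = YH.tz ⟨i, Nat.lt_of_succ_lt hi⟩ (s : ZMod d) * YH.tz ⟨i + 1, hi⟩ (-(s : ZMod d)) := by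
    intro s hs
    rw [← YH.tz_natCast, ← YH.tz_natCast, Nat.cast_sub (Finset.mem_range.mp hs).le]
    simp
  rw [Finset.sum_congr rfl h]
  exact Finset.sum_nbij' (fun s => (s : ZMod d)) ZMod.val (by simp) (by simp [ZMod.val_lt])
    (fun s hs => ZMod.val_cast_of_lt (Finset.mem_range.mp hs)) (by simp) (by simp)

/-- Multiplication by e averages over opposite shifts of the two exponents. -/
lemma tr_tz_tz_e_mul (tr : YH d u 2 →ₗ[ℂ] ℂ) (a b : ZMod d) (c : YH d u 2) :
    tr (YH.tz 0 a * YH.tz 1 b * (YH.e 0 (Nat.lt_succ_self _) * c))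
      = (d : ℂ)⁻¹ * ∑ s, tr (YH.tz 0 (a + s) * YH.tz 1 (b - s) * c) := by
  rw [YH.e_eq_sum_tz, smul_mul_assoc, mul_smul_comm, map_smul, Finset.sum_mul, Finset.mul_sum,
    map_sum, smul_eq_mul]
  congr 1
  refine Finset.sum_congr rfl fun s _ => ?_
  congr 1
  rw [sub_eq_add_neg, YH.tz_add, YH.tz_add]
  change YH.tz 0 a * YH.tz 1 b * (YH.tz 0 s * YH.tz 1 (-s) * c) = _
  rw [← mul_assoc, ← mul_assoc, mul_assoc (YH.tz 0 a), (YH.tz_commute 1 0 b s).eq]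
  simp only [mul_assoc]

namespace IsJuyumayaTrace

lemma framing_tz (h : IsJuyumayaTrace d u z x tr) (hx : x 0 = 1) (b : YH d u n) (a : ZMod d) :
    tr (n + 1) (YH.incl d u n b * YH.tz (Fin.last n) a) = x a * tr n b := by
  rw [YH.tz, h.framing_all hx, ZMod.natCast_zmod_val]

lemma tr_one (h : IsJuyumayaTrace d u z x tr) (hx : x 0 = 1) (a : ZMod d) :
    tr 1 (YH.tz 0 a) = x a := by
  have := h.framing_tz hx (1 : YH d u 0) a
  rw [map_one, one_mul, h.one, mul_one] at this
  exact this

lemma tr_two (h : IsJuyumayaTrace d u z x tr) (hx : x 0 = 1) (a b : ZMod d) :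
    tr 2 (YH.tz 0 a * YH.tz 1 b) = x a * x b := by
  have := h.framing_tz hx (YH.tz 0 a : YH d u 1) b
  rw [YH.incl_tz, h.tr_one hx, _root_.mul_comm (x b)] at this
  exact this

lemma tr_two_g (h : IsJuyumayaTrace d u z x tr) (hx : x 0 = 1) (a b : ZMod d) :
    tr 2 (YH.tz 0 a * YH.tz 1 b * YH.g 0 (Nat.lt_succ_self _)) = z * x (a + b) := by
  have h1 := YH.tz_right_mul_g (d := d) (u := u) 0 (Nat.lt_succ_self 1) b
  change YH.tz 1 b * _ = _ * YH.tz 0 b at h1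
  have h2 := h.braiding 0 (YH.tz 0 (a + b))
  rw [YH.incl_tz, h.tr_one hx] at h2
  rw [← h2, mul_assoc, h1, ← mul_assoc, h.mul_comm, ← mul_assoc, ← YH.tz_add, add_comm]
  rfl

/-- From the quadratic relation. In the e g term the trace depends only on the sum of the exponents,
so the average is over a constant. -/
lemma tr_two_g_sq (h : IsJuyumayaTrace d u z x tr) (hx : x 0 = 1) (a b : ZMod d) :
    tr 2 (YH.tz 0 a * YH.tz 1 b * (YH.g 0 (Nat.lt_succ_self _) * YH.g 0 (Nat.lt_succ_self _)))
      = x a * x b + (u - 1) * ((d : ℂ)⁻¹ * ∑ s, x (a + s) * x (b - s))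
        + (u - 1) * (z * x (a + b)) := by
  have he := tr_tz_tz_e_mul (tr 2) a b 1
  have heg := tr_tz_tz_e_mul (tr 2) a b (YH.g 0 (Nat.lt_succ_self _))
  simp only [mul_one, h.tr_two hx, h.tr_two_g hx] at he heg
  rw [← sq, YH.quadratic, mul_add, mul_add, mul_one, mul_smul_comm, mul_smul_comm, map_add,
    map_add, map_smul, map_smul, h.tr_two hx, he, heg, smul_eq_mul, smul_eq_mul]
  have hd : (d : ℂ) ≠ 0 := NeZero.ne _
  have hs : ∀ s : ZMod d, a + s + (b - s) = a + b := fun s => by ring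
  simp only [hs, Finset.sum_const, Finset.card_univ, ZMod.card, nsmul_eq_mul]
  rw [inv_mul_cancel_left₀ hd]

/-- Each of the six words is reduced to two strands by the rule for the last strand. The two words
of length two both give z² x_{a+b+c}. The longest word gives z times a trace with g², which produces
the convolution term. -/
lemma tr_three (h : IsJuyumayaTrace d u z x tr) (hx : x 0 = 1) (a b c : ZMod d) :
    tr 3 (YH.tz 0 a * YH.tz 1 b * YH.tz 2 c * YH.steinberg 0 (Nat.lt_succ_self _))
      = x a * x b * x c + z * x (a + b) * x c + z * (x a * x (b + c)) + 2 * z ^ 2 * x (a + b + c)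
        + z * (x b * x (a + c) + (u - 1) * ((d : ℂ)⁻¹ * ∑ s, x (b + s) * x (a + c - s))
          + (u - 1) * (z * x (a + b + c))) := by
  set P : YH d u 2 := YH.tz 0 a * YH.tz 1 b with hP
  set g : YH d u 2 := YH.g 0 (Nat.lt_succ_self _) with hg
  set T : YH d u 3 := YH.tz (Fin.last 2) c with hT
  set G : YH d u 3 := YH.g 1 (Nat.lt_succ_self _) with hG
  have hPi : (YH.tz 0 a * YH.tz 1 b : YH d u 3) = YH.incl d u 2 P := by
    rw [hP, map_mul, YH.incl_tz, YH.incl_tz]; rfl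
  have hs : (YH.steinberg 0 (Nat.lt_succ_self _) : YH d u 3)
      = YH.incl d u 2 g * G * YH.incl d u 2 g + G * YH.incl d u 2 g + YH.incl d u 2 g * G
        + YH.incl d u 2 g + G + 1 := by
    rw [hg, YH.incl_g]; rfl
  have hTg : T * YH.incl d u 2 g = YH.incl d u 2 g * T := (YH.tz_last_commute_incl c g).eq
  have hcP : (YH.tz 1 c : YH d u 2) * P = YH.tz 0 a * YH.tz 1 (b + c) := by
    rw [hP, (YH.tz_commute 1 0 c a).left_comm, ← YH.tz_add, add_comm c]
  have v1 : tr 3 (YH.incl d u 2 P * T) = x a * x b * x c := by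
    rw [h.framing_tz hx, h.tr_two hx, _root_.mul_comm]
  have vg : tr 3 (YH.incl d u 2 P * T * YH.incl d u 2 g) = z * x (a + b) * x c := by
    rw [mul_assoc, hTg, ← mul_assoc, ← map_mul, h.framing_tz hx, h.tr_two_g hx, _root_.mul_comm]
  have vG : tr 3 (YH.incl d u 2 P * T * G) = z * (x a * x (b + c)) := by
    have := h.tr_incl_tz_g_incl P 1 c
    rw [map_one, mul_one, mul_one] at this
    rw [this]
    change z * tr 2 (YH.tz 1 c * P) = _
    rw [hcP, h.tr_two hx]
  have vGg : tr 3 (YH.incl d u 2 P * T * G * YH.incl d u 2 g) = z * (z * x (a + b + c)) := by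
    rw [h.tr_incl_tz_g_incl P g c]
    change z * tr 2 (YH.tz 1 c * g * P) = _
    rw [h.mul_comm, ← mul_assoc, ← (show Commute (YH.tz 1 c) P from
      ((YH.tz_commute 1 0 c a).mul_right (YH.tz_commute 1 1 c b))).eq, hcP, h.tr_two_g hx,
      add_assoc]
  have vgG : tr 3 (YH.incl d u 2 P * T * (YH.incl d u 2 g * G)) = z * (z * x (a + b + c)) := by
    have := h.tr_incl_tz_g_incl (P * g) 1 c
    rw [map_one, mul_one, mul_one, map_mul (YH.incl d u _)] at this
    rw [← mul_assoc, mul_assoc _ T, hTg, ← mul_assoc]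
    refine this.trans ?_
    change z * tr 2 (YH.tz 1 c * (P * g)) = _
    rw [← mul_assoc, hcP, h.tr_two_g hx, add_assoc]
  have vgGg : tr 3 (YH.incl d u 2 P * T * (YH.incl d u 2 g * G * YH.incl d u 2 g))
      = z * (x b * x (a + c) + (u - 1) * ((d : ℂ)⁻¹ * ∑ s, x (b + s) * x (a + c - s))
          + (u - 1) * (z * x (a + b + c))) := by
    have := h.tr_incl_tz_g_incl (P * g) g c
    rw [map_mul (YH.incl d u _)] at this
    rw [← mul_assoc, ← mul_assoc, mul_assoc _ T, hTg, ← mul_assoc]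
    refine this.trans ?_
    have h0 := YH.tz_left_mul_g (d := d) (u := u) 0 (Nat.lt_succ_self 1) a
    change YH.tz 0 a * g = g * YH.tz 1 a at h0
    have h1 := YH.tz_right_mul_g (d := d) (u := u) 0 (Nat.lt_succ_self 1) b
    change YH.tz 1 b * g = g * YH.tz 0 b at h1
    -- Moving the framings past g brings the two copies of g together.
    have hPg : P * g = g * (YH.tz 0 b * YH.tz 1 a) := by
      rw [hP, mul_assoc, h1, ← mul_assoc, h0, mul_assoc, (YH.tz_commute 1 0 a b).eq]
    change z * tr 2 (YH.tz 1 c * g * (P * g)) = _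
    rw [hPg, ← mul_assoc, mul_assoc (YH.tz 1 c), mul_assoc (YH.tz 1 c), h.mul_comm,
      mul_assoc, mul_assoc, mul_assoc (YH.tz 0 b), ← YH.tz_add, ← mul_assoc, h.mul_comm, h.tr_two_g_sq hx,
      show b + (a + c) = a + b + c by ring]
  rw [hPi, hs]
  change tr 3 (YH.incl d u 2 P * T * _) = _
  simp only [mul_add, mul_one, map_add]
  rw [← mul_assoc _ G, vgGg, vGg, vgG, vg, vG, v1]
  ring

end IsJuyumayaTrace

lemma YH.incl_r (i : ℕ) (hi : i + 2 < n) :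
    YH.incl d u n (YH.r i hi) = YH.r i (Nat.lt_succ_of_lt hi) := by
  simp only [YH.r, map_mul, map_sum, map_pow, YH.incl_t, YH.incl_steinberg]
  rfl

/-- Compatibility reduces the necessary condition to three strands, whatever n ≥ 3 is. -/
lemma IsJuyumayaTrace.tz_mul_r (h : IsJuyumayaTrace d u z x tr) (hn : 3 ≤ n) (S : ZMod d) :
    tr n (YH.tz ⟨0, by omega⟩ S * YH.r 0 (by omega))
      = tr 3 (YH.tz 0 S * YH.r 0 (Nat.lt_succ_self _)) := by
  induction n, hn using Nat.le_induction with
  | base => rfl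
  | succ n hn ih =>
      rw [← ih, ← h.compatible n, map_mul (YH.incl d u n), YH.incl_tz, YH.incl_r]
      rfl

/-- With y the sum of F, each free summation variable contributes a factor d. The total is y³ + (u +
2)dz y² + (u + 1)(dz)² y, which factors. -/
lemma sum_fourier_cubic (F : ZMod d → ℂ) (u z : ℂ) :
    ∑ a, ∑ b, ∑ c, (F a * F b * F c + z * F (a + b) * F c + z * (F a * F (b + c))
        + 2 * z ^ 2 * F (a + b + c)
        + z * (F b * F (a + c) + (u - 1) * ((d : ℂ)⁻¹ * ∑ s, F (b + s) * F (a + c - s))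
          + (u - 1) * (z * F (a + b + c))))
      = (∑ a, F a) * (∑ a, F a + d * z) * (∑ a, F a + d * z * (u + 1)) := by
  have hd : (d : ℂ) ≠ 0 := NeZero.ne _
  have hl : ∀ a, ∑ b, F (a + b) = ∑ b, F b := fun a => Equiv.sum_comp (Equiv.addLeft a) F
  have hk : ∀ r : ℂ, ∑ _a : ZMod d, r = d * r := fun r => by
    rw [Finset.sum_const, Finset.card_univ, ZMod.card, nsmul_eq_mul]
  have hs : ∀ a : ZMod d, ∑ b, ∑ c, ∑ s, F (b + s) * F (a + c - s) = d * (∑ b, F b) ^ 2 := by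
    intro a
    have h1 : ∀ b, ∑ c, ∑ s, F (b + s) * F (a + c - s) = (∑ b, F b) ^ 2 := by
      intro b
      rw [Finset.sum_comm]
      have : ∀ c s : ZMod d, a + c - s = (a - s) + c := fun c s => by ring
      simp only [this, ← Finset.mul_sum, hl, ← Finset.sum_mul, sq]
    simp only [h1, hk]
  have h1 : ∑ a, ∑ b, ∑ c, F a * F b * F c = (∑ a, F a) ^ 3 := by
    simp only [← Finset.mul_sum, ← Finset.sum_mul]; ring
  have h2 : ∑ a, ∑ b, ∑ c, z * F (a + b) * F c = z * (d * (∑ a, F a) ^ 2) := by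
    simp only [← Finset.mul_sum, ← Finset.sum_mul, hl, hk]; ring
  have h3 : ∑ a, ∑ b, ∑ c, z * (F a * F (b + c)) = z * (d * (∑ a, F a) ^ 2) := by
    simp only [← Finset.mul_sum, ← Finset.sum_mul, hl, hk]; ring
  simp only [Finset.sum_add_distrib, h1, h2, h3, mul_add z]
  simp only [← Finset.mul_sum, ← Finset.sum_mul, hl, hs, hk]
  field_simp
  ring

/-- The necessary condition for the trace to pass: the Fourier transform of `x` takes only three
values. -/
theorem dft_of_tracePasses (hn : 3 ≤ n) (hx : x 0 = 1) (h : TracePasses d u n z x) (k : ZMod d) :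
    ZMod.dft x k = 0 ∨ ZMod.dft x k = -(d * z) ∨ ZMod.dft x k = -(d * z * (u + 1)) := by
  obtain ⟨tr, htr, h0⟩ := tracePasses_iff.mp h
  have hr : ∀ S : ZMod d, tr 3 (YH.tz 0 S * YH.r 0 (Nat.lt_succ_self _)) = 0 := by
    intro S
    rw [← htr.tz_mul_r hn S]
    refine h0 _ (TwoSidedIdeal.mul_mem_left _ _ _ (TwoSidedIdeal.subset_span ?_))
    exact ⟨0, by omega, rfl⟩
  -- All arguments in `tr_three` add up to a + b + c in every term. The character of the total
  -- therefore distributes over the values of x and turns each x into F, whose sum is y_k.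
  set F : ZMod d → ℂ := fun a => ZMod.stdAddChar (-(a * k)) * x a with hF
  have hy : ZMod.dft x k = ∑ a, F a := by simp only [ZMod.dft_apply, smul_eq_mul, hF]
  set H : ZMod d → ZMod d → ZMod d → ℂ := fun a b c =>
    ZMod.stdAddChar (-((a + b + c) * k))
      * tr 3 (YH.tz 0 a * YH.tz 1 b * YH.tz 2 c * YH.steinberg 0 (Nat.lt_succ_self _)) with hH
  have hsum : ∑ a, ∑ b, ∑ c, H a b c = 0 := by
    have hS : ∀ S : ZMod d, ∑ α, ∑ β, H (S + α) β (-α - β) = 0 := by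
      intro S
      have h1 := hr S
      simp only [YH.r, ← mul_assoc, Finset.mul_sum, Finset.sum_mul, map_sum] at h1
      have h2 : ∀ α β : ZMod d, H (S + α) β (-α - β) = ZMod.stdAddChar (-(S * k))
          * tr 3 (YH.tz 0 S * YH.t 0 ^ α.val * YH.t 1 ^ β.val * YH.t 2 ^ (-α - β).val
            * YH.steinberg 0 (Nat.lt_succ_self _)) := by
        intro α β
        simp only [hH]
        rw [show S + α + β + (-α - β) = S by ring, YH.tz_add]
        rfl
      simp only [h2, ← Finset.mul_sum]
      exact mul_eq_zero_of_right _ h1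
    -- The map (S, α, β) ↦ (S + α, β, -α - β) is a bijection of triples, with S recovered as the sum
    -- of the three entries.
    have h3 : ∑ S : ZMod d, ∑ α, ∑ β, H (S + α) β (-α - β) = ∑ a, ∑ b, ∑ c, H a b c := by
      rw [Finset.sum_comm]
      have h4 : ∀ α : ZMod d, ∑ S : ZMod d, ∑ β, H (S + α) β (-α - β)
          = ∑ a, ∑ β, H a β (-α - β) := fun α =>
        Equiv.sum_comp (Equiv.addRight α) fun a => ∑ β, H a β (-α - β)
      simp only [h4]
      rw [Finset.sum_comm]
      refine Finset.sum_congr rfl fun a _ => ?_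
      rw [Finset.sum_comm]
      refine Finset.sum_congr rfl fun b _ => ?_
      have h5 : ∀ α : ZMod d, -α - b = (Equiv.subLeft (-b)) α := fun α => by
        simp only [Equiv.subLeft_apply]; ring
      simp only [h5]
      exact Equiv.sum_comp (Equiv.subLeft (-b)) fun c => H a b c
    rw [← h3]
    exact Finset.sum_eq_zero fun S _ => hS S
  have hHF : ∀ a b c, H a b c = F a * F b * F c + z * F (a + b) * F c + z * (F a * F (b + c))
        + 2 * z ^ 2 * F (a + b + c)
        + z * (F b * F (a + c) + (u - 1) * ((d : ℂ)⁻¹ * ∑ s, F (b + s) * F (a + c - s))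
          + (u - 1) * (z * F (a + b + c))) := by
    intro a b c
    have hm : ∀ p q : ZMod d, p + q = a + b + c → F p * F q
        = ZMod.stdAddChar (-((a + b + c) * k)) * (x p * x q) := by
      intro p q hpq
      simp only [hF]
      rw [← hpq, add_mul, neg_add, AddChar.map_add_eq_mul]
      ring
    have hm3 : F a * F b * F c = ZMod.stdAddChar (-((a + b + c) * k)) * (x a * x b * x c) := by
      simp only [hF]
      rw [add_mul, add_mul, neg_add, neg_add, AddChar.map_add_eq_mul, AddChar.map_add_eq_mul]
      ring
    have hs : ∑ s, F (b + s) * F (a + c - s)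
        = ZMod.stdAddChar (-((a + b + c) * k)) * ∑ s, x (b + s) * x (a + c - s) := by
      rw [Finset.mul_sum]
      exact Finset.sum_congr rfl fun s _ => hm _ _ (by ring)
    have e1 := hm (a + b) c rfl
    have e2 := hm a (b + c) (by ring)
    have e3 := hm b (a + c) (by ring)
    simp only [hH]
    rw [htr.tr_three hx, hm3, hs, mul_assoc z (F (a + b)), e1, e2, e3]
    simp only [hF]
    ring
  simp only [hHF, sum_fourier_cubic, ← hy] at hsum
  rcases mul_eq_zero.mp hsum with h1 | h1
  · rcases mul_eq_zero.mp h1 with h2 | h2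
    · exact Or.inl h2
    · exact Or.inr (Or.inl (eq_neg_of_add_eq_zero_left h2))
  · exact Or.inr (Or.inr (eq_neg_of_add_eq_zero_left h1))

end necessary

/-! ### Invariance under the framed Markov moves -/

section invariant

variable {d : ℕ} [NeZero d] {u : ℂ} (hu : u ≠ 0) {n : ℕ}

lemma gammaRep_σ (i : ℕ) (hi : i + 1 < n) :
    ((gammaRep (d := d) hu n (FramedBraidGroup.σ i hi) : (YH d u n)ˣ) : YH d u n) = YH.g i hi := by
  simp [gammaRep, FramedBraidGroup.lift, FramedBraidGroup.σ, YH.unitGen]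

lemma gammaRep_σ_inv (i : ℕ) (hi : i + 1 < n) :
    ((gammaRep (d := d) hu n (FramedBraidGroup.σ i hi)⁻¹ : (YH d u n)ˣ) : YH d u n)
      = YH.gInv i hi := by
  simp [gammaRep, FramedBraidGroup.lift, FramedBraidGroup.σ, YH.unitGen]

lemma gammaRep_incl (α : FramedBraidGroup n) :
    ((gammaRep (d := d) hu (n + 1) (FramedBraidGroup.incl n α) : (YH d u (n + 1))ˣ) :
      YH d u (n + 1)) = YH.incl d u n ((gammaRep hu n α : (YH d u n)ˣ) : YH d u n) := by
  have h : (gammaRep (d := d) hu (n + 1)).comp (FramedBraidGroup.incl n)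
      = (Units.map (YH.incl d u n : YH d u n →* YH d u (n + 1))).comp (gammaRep hu n) := by
    refine PresentedGroup.ext fun x => Units.ext ?_
    cases x with
    | g i hi =>
        simp [gammaRep, FramedBraidGroup.incl, FramedBraidGroup.inclGen, FramedBraidGroup.lift,
          FramedBraidGroup.σ, YH.unitGen, YH.incl_g]
    | t j =>
        simp [gammaRep, FramedBraidGroup.incl, FramedBraidGroup.inclGen, FramedBraidGroup.lift,
          FramedBraidGroup.t, YH.unitGen, YH.incl_t]
  exact congrArg Units.val (DFunLike.congr_fun h α)

lemma exponent_incl (α : FramedBraidGroup n) :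
    FramedBraidGroup.exponent (n + 1) (FramedBraidGroup.incl n α)
      = FramedBraidGroup.exponent n α := by
  have h : (FramedBraidGroup.exponent (n + 1)).comp (FramedBraidGroup.incl n)
      = FramedBraidGroup.exponent n := by
    refine PresentedGroup.ext fun x => ?_
    cases x <;> simp [FramedBraidGroup.exponent, FramedBraidGroup.incl, FramedBraidGroup.inclGen,
      FramedBraidGroup.lift, FramedBraidGroup.σ, FramedBraidGroup.t]
  exact DFunLike.congr_fun h α

lemma exponent_σ (i : ℕ) (hi : i + 1 < n) :
    FramedBraidGroup.exponent n (FramedBraidGroup.σ i hi) = Multiplicative.ofAdd 1 := by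
  simp [FramedBraidGroup.exponent, FramedBraidGroup.lift, FramedBraidGroup.σ]

variable {z E : ℂ} {x : ZMod d → ℂ} {κ : ZMod d × Bool → ℂ}

lemma IsMarkovWeight.trace_gInv (h : IsMarkovWeight u z E x κ) (a : YH d u (n + 1)) :
    wordTrace u κ (n + 2) (YH.incl d u (n + 1) a * YH.gInv n (Nat.lt_succ_self _))
      = (z * u⁻¹ + (u⁻¹ - 1) * E) * wordTrace u κ (n + 1) a := by
  simp only [YH.gInv, mul_add, mul_smul_comm, map_add, map_smul, h.trace_g, h.trace_e,
    h.trace_e_mul_g, smul_eq_mul]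
  ring

/-- The normalized trace is constant on the classes of framed braid equivalence. -/
lemma IsMarkovWeight.gammaValue_eq_of_move (h : IsMarkovWeight u z E x κ) (hz : z ≠ 0) {s : ℂ}
    (hs : s ^ 2 = u) (hE : E = -(z * (u + 1))) {α β : Σ n : ℕ, FramedBraidGroup (n + 1)}
    (hαβ : FramedMarkovMove α β) :
    gammaValue hu z s (wordTrace u κ) α.2 = gammaValue hu z s (wordTrace u κ) β.2 := by
  have hs0 : s ≠ 0 := by rintro rfl; exact hu (by rw [← hs]; ring)
  cases hαβ with
  | conj n α β =>
      simp only [gammaValue, map_mul, map_inv, mul_inv_cancel_comm, Units.val_mul]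
      rw [wordTrace_mul_comm, ← mul_assoc, Units.inv_mul, one_mul]
  | stabPos n α =>
      simp only [gammaValue, map_mul, Units.val_mul, gammaRep_incl, gammaRep_σ, h.trace_g,
        exponent_incl, exponent_σ, toAdd_mul, toAdd_ofAdd, zpow_add₀ hs0, zpow_one, pow_succ]
      field_simp
  | stabNeg n α =>
      rw [gammaValue, gammaValue, map_mul (gammaRep hu _), Units.val_mul, gammaRep_incl,
        gammaRep_σ_inv, h.trace_gInv, map_mul, map_inv, exponent_incl, exponent_σ, toAdd_mul,
        toAdd_inv, toAdd_ofAdd, zpow_add₀ hs0, zpow_neg, zpow_one, pow_succ]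
      -- The value of E makes a negative stabilization multiply the trace by zu = z s². The new
      -- factors 1/(zs) and s⁻¹ cancel it.
      have hc : z * u⁻¹ + (u⁻¹ - 1) * E = z * s ^ 2 := by
        rw [hE, hs]; field_simp; ring
      rw [hc]
      field_simp

end invariant

/-! ### The two families of traces -/

section families

variable {d : ℕ} {u z : ℂ} {D : Finset (ZMod d)}

lemma lambdaD_eq (hu : u ≠ 0) (hD : D.Nonempty) (hu1 : u + 1 ≠ 0)
    (hz : z = -1 / ((u + 1) * D.card)) : lambdaD u z D = u := by
  have hc : (D.card : ℂ) ≠ 0 := Nat.cast_ne_zero.mpr hD.card_pos.ne'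
  rw [lambdaD, hz]
  field_simp
  ring

variable [NeZero d]

/-- With both weights nonzero, the Markov conditions force p = -z|D| and q = up, and p + q = 1 gives
the values used. -/
lemma isMarkovWeight_two (hD : D.Nonempty) (hu1 : u + 1 ≠ 0)
    (hz : z = -1 / ((u + 1) * D.card)) :
    IsMarkovWeight u z (D.card : ℂ)⁻¹ (eSolution D)
      (subsetWeight D (1 / (u + 1)) (u / (u + 1))) := by
  have hc : (D.card : ℂ) ≠ 0 := Nat.cast_ne_zero.mpr hD.card_pos.ne'
  refine isMarkovWeight_subsetWeight hD ?_ ?_ ?_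
  · field_simp; ring
  · rw [hz]; field_simp
  · rw [hz]; field_simp; ring

/-- Giving the second state weight 0 makes its condition void; the other one becomes z|D| = -1. -/
lemma isMarkovWeight_one (hD : D.Nonempty) (hz : z = -1 / D.card) :
    IsMarkovWeight u z (D.card : ℂ)⁻¹ (eSolution D) (subsetWeight D 1 0) := by
  have hc : (D.card : ℂ) ≠ 0 := Nat.cast_ne_zero.mpr hD.card_pos.ne'
  refine isMarkovWeight_subsetWeight hD ?_ ?_ ?_
  · ring
  · rw [hz]; field_simp
  · ring

lemma mem_setD₁ {x : ZMod d → ℂ} {k : ZMod d} :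
    k ∈ setD₁ z x ↔ ZMod.dft x k ≠ 0 ∧ ZMod.dft x k = -(d * z) := by simp [setD₁]

lemma mem_setD₂ {x : ZMod d → ℂ} {k : ZMod d} :
    k ∈ setD₂ u z x ↔ ZMod.dft x k ≠ 0 ∧ ZMod.dft x k = -(d * z * (u + 1)) := by simp [setD₂]

lemma setD₂_of_setD₁_eq_empty {x : ZMod d → ℂ} (hx : x 0 = 1)
    (h3 : ∀ k, ZMod.dft x k = 0 ∨ ZMod.dft x k = -(d * z) ∨ ZMod.dft x k = -(d * z * (u + 1)))
    (h1 : setD₁ z x = ∅) :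
    (setD₂ u z x).Nonempty ∧ x = eSolution (setD₂ u z x) ∧ u + 1 ≠ 0 ∧
      z = -1 / ((u + 1) * (setD₂ u z x).card) := by
  have hd : (d : ℂ) ≠ 0 := NeZero.ne _
  have hk : ∀ k, ZMod.dft x k = if k ∈ setD₂ u z x then -(d * z * (u + 1)) else 0 := by
    intro k
    have h : k ∉ setD₁ z x := by simp [h1]
    have h3k := h3 k
    rw [mem_setD₁] at h
    simp only [mem_setD₂]
    split_ifs with h' <;> tauto
  obtain ⟨hne, hC, he⟩ := eq_eSolution_of_dft hx hk
  have hc : ((setD₂ u z x).card : ℂ) ≠ 0 := Nat.cast_ne_zero.mpr hne.card_pos.ne'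
  -- If u = -1, the constant value of the transform would be 0, while multiplied by the size of the
  -- support it must equal d.
  have hu1 : u + 1 ≠ 0 := by
    intro h0
    rw [h0] at hC
    exact hd (by rw [← hC]; ring)
  refine ⟨hne, he, hu1, ?_⟩
  rw [eq_div_iff (mul_ne_zero hu1 hc)]
  refine mul_left_cancel₀ hd ?_
  linear_combination -hC

lemma setD₁_of_setD₂_eq_empty {x : ZMod d → ℂ} (hx : x 0 = 1)
    (h3 : ∀ k, ZMod.dft x k = 0 ∨ ZMod.dft x k = -(d * z) ∨ ZMod.dft x k = -(d * z * (u + 1)))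
    (h2 : setD₂ u z x = ∅) :
    (setD₁ z x).Nonempty ∧ x = eSolution (setD₁ z x) ∧ z = -1 / (setD₁ z x).card := by
  have hd : (d : ℂ) ≠ 0 := NeZero.ne _
  have hk : ∀ k, ZMod.dft x k = if k ∈ setD₁ z x then -(d * z) else 0 := by
    intro k
    have h : k ∉ setD₂ u z x := by simp [h2]
    have h3k := h3 k
    rw [mem_setD₂] at h
    simp only [mem_setD₁]
    split_ifs with h' <;> tauto
  obtain ⟨hne, hC, he⟩ := eq_eSolution_of_dft hx hk
  have hc : ((setD₁ z x).card : ℂ) ≠ 0 := Nat.cast_ne_zero.mpr hne.card_pos.ne'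
  refine ⟨hne, he, ?_⟩
  rw [eq_div_iff hc]
  refine mul_left_cancel₀ hd ?_
  linear_combination -hC

lemma setD₁_or_setD₂_eq_empty (hu : u ≠ 0) {x : ZMod d → ℂ} (h : IsESolution x) :
    setD₁ z x = ∅ ∨ setD₂ u z x = ∅ := by
  have hd : (d : ℂ) ≠ 0 := NeZero.ne _
  obtain ⟨C, hC⟩ := (isESolution_iff_dft h.1).mp h
  have hy : ∀ k, ZMod.dft x k ≠ 0 → ZMod.dft x k = C := fun k hk =>
    mul_right_cancel₀ hk (by rw [← sq, hC k])
  by_contra! hne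
  obtain ⟨⟨k, hk⟩, l, hl⟩ := hne
  rw [mem_setD₁] at hk
  rw [mem_setD₂] at hl
  -- A solution of the E-system has only one nonzero Fourier value, so -dz and -dz(u + 1) would
  -- coincide.
  have h1 : (d : ℂ) * z * u = 0 := by
    linear_combination -hk.2 + hl.2 + hy k hk.1 - hy l hl.1
  have h2 : (d : ℂ) * z = 0 := (mul_eq_zero.mp h1).resolve_right hu
  exact hk.1 (by rw [hk.2, h2, neg_zero])

lemma setD_eSolution_two (hu : u ≠ 0) (hD : D.Nonempty) (hu1 : u + 1 ≠ 0)
    (hz : z = -1 / ((u + 1) * D.card)) :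
    setD₁ z (eSolution D) = ∅ ∧ setD₂ u z (eSolution D) = D := by
  have hd : (d : ℂ) ≠ 0 := NeZero.ne _
  have hc : (D.card : ℂ) ≠ 0 := Nat.cast_ne_zero.mpr hD.card_pos.ne'
  have h1 : (d : ℂ) * (D.card : ℂ)⁻¹ = -(d * z * (u + 1)) := by rw [hz]; field_simp
  have h2 : (d : ℂ) * (D.card : ℂ)⁻¹ ≠ -(d * z) := by
    intro h
    rw [hz] at h
    field_simp at h
    exact hu (by linear_combination h)
  refine ⟨Finset.eq_empty_of_forall_notMem fun k hk => ?_, Finset.ext fun k => ?_⟩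
  · rw [mem_setD₁, dft_eSolution] at hk
    split_ifs at hk
    · exact h2 hk.2
    · exact hk.1 rfl
  · rw [mem_setD₂, dft_eSolution]
    split_ifs with h
    · exact ⟨fun _ => h, fun _ => ⟨mul_ne_zero hd (inv_ne_zero hc), h1⟩⟩
    · exact ⟨fun h' => absurd rfl h'.1, fun h' => absurd h' h⟩

lemma setD_eSolution_one (hu : u ≠ 0) (hD : D.Nonempty) (hz : z = -1 / D.card) :
    setD₂ u z (eSolution D) = ∅ ∧ setD₁ z (eSolution D) = D := by
  have hd : (d : ℂ) ≠ 0 := NeZero.ne _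
  have hc : (D.card : ℂ) ≠ 0 := Nat.cast_ne_zero.mpr hD.card_pos.ne'
  have h1 : (d : ℂ) * (D.card : ℂ)⁻¹ = -(d * z) := by rw [hz]; field_simp
  have h2 : (d : ℂ) * (D.card : ℂ)⁻¹ ≠ -(d * z * (u + 1)) := by
    intro h
    rw [hz] at h
    field_simp at h
    exact hu (by linear_combination -h)
  refine ⟨Finset.eq_empty_of_forall_notMem fun k hk => ?_, Finset.ext fun k => ?_⟩
  · rw [mem_setD₂, dft_eSolution] at hk
    split_ifs at hk
    · exact h2 hk.2
    · exact hk.1 rfl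
  · rw [mem_setD₁, dft_eSolution]
    split_ifs with h
    · exact ⟨fun _ => h, fun _ => ⟨mul_ne_zero hd (inv_ne_zero hc), h1⟩⟩
    · exact ⟨fun h' => absurd rfl h'.1, fun h' => absurd h' h⟩

end families

end

end FramizationTL

theorem mainTheorem2 (d : ℕ) [NeZero d] (u : ℂ) (hu : u ≠ 0) :
    -- the trace is unique
    (∀ (z : ℂ) (x : ZMod d → ℂ) (tr tr' : ∀ n, YH d u n →ₗ[ℂ] ℂ), x 0 = 1 →
      IsJuyumayaTrace d u z x tr → IsJuyumayaTrace d u z x tr' → tr = tr') ∧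
    -- the solutions of the E-system are parametrized by the non-empty sets of residues
    (∀ D : Finset (ZMod d), D.Nonempty → IsESolution (eSolution D)) ∧
    (∀ x : ZMod d → ℂ, IsESolution x →
      ∃! D : Finset (ZMod d), D.Nonempty ∧ x = eSolution D) ∧
    -- trace parameters for which the trace passes
    (∀ n, 3 ≤ n → ∀ (z : ℂ) (x : ZMod d → ℂ), x 0 = 1 → TracePasses d u n z x →
      ((setD₁ z x = ∅ ∨ setD₂ u z x = ∅) ↔ IsESolution x) ∧
      (setD₁ z x = ∅ → (setD₂ u z x).Nonempty ∧ x = eSolution (setD₂ u z x) ∧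
        u + 1 ≠ 0 ∧ z = -1 / ((u + 1) * (setD₂ u z x).card)) ∧
      (setD₂ u z x = ∅ → (setD₁ z x).Nonempty ∧ x = eSolution (setD₁ z x) ∧
        z = -1 / (setD₁ z x).card)) ∧
    -- the trace passes for every solution of the E-system
    (∀ n, 3 ≤ n → ∀ D : Finset (ZMod d), D.Nonempty → ∀ z : ℂ,
      (u + 1 ≠ 0 → z = -1 / ((u + 1) * D.card) → TracePasses d u n z (eSolution D) ∧
        setD₁ z (eSolution D) = ∅ ∧ setD₂ u z (eSolution D) = D) ∧
      (z = -1 / D.card → TracePasses d u n z (eSolution D) ∧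
        setD₂ u z (eSolution D) = ∅ ∧ setD₁ z (eSolution D) = D)) ∧
    -- the framed Jones polynomial is well defined
    (∀ D : Finset (ZMod d), D.Nonempty → u + 1 ≠ 0 →
      ∀ z : ℂ, z = -1 / ((u + 1) * D.card) →
        lambdaD u z D = u ∧
        ∀ s : ℂ, s ^ 2 = u →
          ∃ tr : ∀ n, YH d u n →ₗ[ℂ] ℂ, IsJuyumayaTrace d u z (eSolution D) tr ∧
            ∃ V : FramedLink → ℂ, ∀ (n : ℕ) (α : FramedBraidGroup (n + 1)),
              V (braidClosure α) = gammaValue hu z s tr α) := by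
  refine ⟨fun z x tr tr' hx h h' => h.unique hx h', fun D hD => isESolution_eSolution hD,
    fun x h => existsUnique_eSolution h, fun n hn z x hx hp => ?_,
    fun n _ D hD z => ⟨fun hu1 hz => ?_, fun hz => ?_⟩, fun D hD hu1 z hz => ?_⟩
  · have h3 := dft_of_tracePasses hn hx hp
    refine ⟨⟨?_, setD₁_or_setD₂_eq_empty hu⟩, setD₂_of_setD₁_eq_empty hx h3,
      setD₁_of_setD₂_eq_empty hx h3⟩
    rintro (h1 | h2)
    · obtain ⟨hne, he, -⟩ := setD₂_of_setD₁_eq_empty hx h3 h1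
      exact he ▸ isESolution_eSolution hne
    · obtain ⟨hne, he, -⟩ := setD₁_of_setD₂_eq_empty hx h3 h2
      exact he ▸ isESolution_eSolution hne
  · exact ⟨(isMarkovWeight_two hD hu1 hz).tracePasses n, setD_eSolution_two hu hD hu1 hz⟩
  · exact ⟨(isMarkovWeight_one hD hz).tracePasses n, setD_eSolution_one hu hD hz⟩
  · refine ⟨lambdaD_eq hu hD hu1 hz, fun s hs => ?_⟩
    have hκ := isMarkovWeight_two hD hu1 hz
    have hc : (D.card : ℂ) ≠ 0 := Nat.cast_ne_zero.mpr hD.card_pos.ne'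
    have hz0 : z ≠ 0 := by
      rw [hz]
      exact div_ne_zero (by norm_num) (mul_ne_zero hu1 hc)
    have hE : (D.card : ℂ)⁻¹ = -(z * (u + 1)) := by
      rw [hz]
      field_simp
    -- Invariance under the elementary moves is all that is needed for a function on links, since
    -- these are the quotient by the equivalence relation that the moves generate.
    exact ⟨_, hκ.isJuyumayaTrace, Quot.lift (fun α => gammaValue hu z s _ α.2)
      fun _ _ h => hκ.gammaValue_eq_of_move hu hz0 hs hE h, fun n α => rfl⟩
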